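/- \textbf{Setting.} A (GP 2) host graph is a finite directed graph, parallel edges and loops allowed, in which every node and every edge carries a list of integers and character strings and is either unmarked or has one mark (red, green, blue; grey for nodes only; dashed for edges only), and in which some nodes are distinguished as roots. A rule $L\Rightarrow R$ with an optional condition is applied by choosing an injective occurrence of $L$ in the host graph together with values of the variables ($x,y,z$: lists; $i,s,t,w$: integers) such that lists and marks agree (an unmarked item matches only unmarked items; the node mark "any" matches every mark and is kept by the rule), roots of $L$ are mapped to roots, the condition holds, and no node to be deleted is incident to an edge outside the occurrence; the occurrence is then replaced by the corresponding instance of $R$. A call of a set of rules non-deterministically applies one of them at some occurrence, and fails if none is applicable. $\mathtt{if}\ C\ \mathtt{then}\ P\ \mathtt{else}\ Q$ executes $C$ on a copy of the current graph, and then executes $P$ on the original graph if $C$ yielded a graph, and $Q$ if $C$ failed; $\mathtt{try}$ is the same except that $P$ is executed on the result of $C$; omitted branches do nothing. The loop $P!$ executes $P$ until it fails and then returns the graph on which $P$ was entered last. The command $\mathtt{fail}$ fails, and a sequence fails as soon as one of its components fails. \textbf{Program.} The program $\mathtt{bellman\text{-}ford}$ is \[\begin{array}{l} \mathtt{Main =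 set\_counter;\ count!;\ (decrement;\ Relax!;\ Clean!)!;\ Final}\\ \mathtt{Relax = root1;\ try\ no\_deg\ else\ ((unmarked\_edge;\ (try\ \{unvisited,\ reduce\});\ finish)!;\ unroot1)}\\ \mathtt{Clean = root2;\ unmark\_edge!;\ unroot2}\\ \mathtt{Final = (root1;\ (unmarked\_edge;\ (if\ reduce\ then\ set\_flag);\ finish)!;\ unroot1)!;}\\ \qquad\qquad\mathtt{(if\ flag\ then\ fail);\ delete\_counter;\ no\_deg\_inv!} \end{array}\] with the following rules, where $x{:}a$ is the list $x$ with $a$ appended, nodes are non-roots unless called roots, and nodes are kept unless stated otherwise. \begin{itemize} \item $\mathtt{set\_counter}$: a grey root with list $x$ becomes a blue non-root with list $x{:}0$, and a new green node with list $0$ and a dashed edge with empty list from the new node to it are added. \item $\mathtt{count}$: a grey node $x$ and a green node $i$ become a blue node $x{:}$"f" and a green node $i+1$. \item $\mathtt{decrement}$: a green node $i$ becomes a green node $i-1$, where $i>0$. \item $\mathtt{root1}$: a blue node becomes a blue root. $\mathtt{unroot1}$: a blue root becomes a grey non-root. $\mathtt{root2}$: a grey node becomes a blue root. $\mathtt{unroot2}$: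 a blue root becomes a blue non-root. None of them changes the list. \item $\mathtt{no\_deg}$: a blue root $x$ is deleted and an unmarked non-root $x$ is added (so it applies to isolated nodes only). $\mathtt{no\_deg\_inv}$: an unmarked node becomes grey. \item $\mathtt{unmarked\_edge}$, $\mathtt{finish}$, $\mathtt{unmark\_edge}$: an edge with arbitrary list from a blue root to a node with mark "any" changes from unmarked to red, from red to blue, and from blue to unmarked, respectively. \item $\mathtt{unvisited}$: given a red edge with list $w$ from a blue root $x{:}s$ to a node $y{:}$"f" with mark "any", the list of the target becomes $y{:}(s+w)$. \item $\mathtt{reduce}$: given a red edge with list $w$ from a blue root $x{:}s$ to a node $y{:}t$ with mark "any", where $s+w<t$, the list of the target becomes $y{:}(s+w)$. \item $\mathtt{set\_flag}$: the list of a green node becomes $-1$. $\mathtt{flag}$: applies, without any change, if there is a green node with list $-1$. \item $\mathtt{delete\_counter}$: given a dashed edge with empty list from a green node to a grey node, the edge and the green node are deleted and the grey node becomes a grey root. \end{itemize} \textbf{Theorem (correctness of $\mathtt{bellman\text{-}ford}$).} Let $G$ be a host graph in which every node is marked grey, there is exactly one root $r$, every edge is unmarked and labelled with a single integer, and no edge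 is a loop. Then every execution of $\mathtt{bellman\text{-}ford}$ on $G$ terminates, with an output graph or with failure. Moreover: \begin{enumerate} \item If $G$ contains a directed cycle whose sum of edge labels is negative and which can be reached from $r$ by a directed path, then every execution fails. \item Otherwise no execution fails, and every execution outputs a graph that is, up to isomorphism, obtained from $G$ as follows: for each node reachable from $r$ by a directed path, its shortest distance from $r$ (the least sum of edge labels over all directed paths from $r$ to it) is appended to its list; the string "f" is appended to the list of every other node; and all edges are marked blue. Everything else (sources, targets and lists of the edges, node marks, the root) is unchanged. \end{enumerate} -/

import Mathlib

/-! ## Host graphs -/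

namespace GP2

/-- Marks. `grey` is used on nodes only, `dashed` on edges only. -/
inductive Mark
  | unmarked | red | green | blue | grey | dashed
  deriving DecidableEq

/-- Atoms occurring in host labels: integers and character strings. -/
inductive Atom
  | int (i : ℤ)
  | str (s : String)
  deriving DecidableEq

/-- The string `f`, consisting of the single character with code 102. -/
def strF : String := String.ofList [Char.ofNat 102]

/-- Host graphs: finite directed graphs, possibly with parallel edges and loops, whose nodes and
edges carry a list of atoms and a mark; some nodes are distinguished as roots. -/
structure HostGraph where
  V : Type
  E : Type
  finV : Finite V
  finE : Finite E
  src : E → V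
  tgt : E → V
  list : V → List Atom
  mark : V → Mark
  root : V → Prop
  elist : E → List Atom
  emark : E → Mark

/-! ## Rules -/

/-- Variables of type `list`. -/
inductive LVar
  | x | y | z
  deriving DecidableEq

/-- Variables of type `int`. -/
inductive IVar
  | i | s | t | w
  deriving DecidableEq

/-- Integer expressions. -/
inductive IntExpr
  | var (v : IVar)
  | const (c : ℤ)
  | add (a b : IntExpr)
  | sub (a b : IntExpr)

/-- List expressions; an integer or a string is a list of length one, and `app` is the list
concatenation written with a colon in GP 2. -/
inductive ListExpr
  | empty
  | var (v : LVar)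
  | int (e : IntExpr)
  | str (s : String)
  | app (a b : ListExpr)

/-- Assignments of host values to variables. -/
structure Assignment where
  L : LVar → List Atom
  I : IVar → ℤ

def IntExpr.eval (α : Assignment) : IntExpr → ℤ
  | .var v => α.I v
  | .const c => c
  | .add a b => a.eval α + b.eval α
  | .sub a b => a.eval α - b.eval α

def ListExpr.eval (α : Assignment) : ListExpr → List Atom
  | .empty => []
  | .var v => α.L v
  | .int e => [Atom.int (e.eval α)]
  | .str s => [Atom.str s]
  | .app a b => a.eval α ++ b.eval α

/-- Rule application conditions. -/
inductive Cond
  | always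
  | gt (a b : IntExpr)
  | lt (a b : IntExpr)

def Cond.Holds (α : Assignment) : Cond → Prop
  | .always => True
  | .gt a b => a.eval α > b.eval α
  | .lt a b => a.eval α < b.eval α

/-- Node marks in rules: a fixed mark (or no mark), or the mark `any` (drawn magenta). -/
inductive RuleMark
  | exact (m : Mark)
  | any

/-- `any` matches every mark; an unmarked rule node matches only unmarked host nodes. -/
def RuleMark.Matches : RuleMark → Mark → Prop
  | .exact m, m' => m' = m
  | .any, m' => m' ≠ Mark.unmarked

/-- The mark of an instantiated right-hand node; `any` keeps the mark bound by the match. -/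
def RuleMark.inst : RuleMark → Mark → Mark
  | .exact m, _ => m
  | .any, old => old

/-- A node of a rule graph: its label, and whether it is a root. -/
structure RuleNode where
  list : ListExpr
  mark : RuleMark
  root : Bool

/-- An edge of a rule graph with node set `N`. -/
structure RuleEdge (N : Type) where
  src : N
  tgt : N
  list : ListExpr
  mark : Mark

/-- Rule graphs with node set `N` and `m` edges. -/
structure RuleGraph (N : Type) where
  node : N → RuleNode
  m : ℕ
  edge : Fin m → RuleEdge N

/-- Conditional rules with `k` interface nodes (kept and relabelled), `d` deleted nodes and `a`
added nodes. All edges of the left-hand side are deleted, all edges of the right-hand side are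
added. -/
structure Rule where
  k : ℕ
  d : ℕ
  a : ℕ
  lhs : RuleGraph (Fin k ⊕ Fin d)
  rhs : RuleGraph (Fin k ⊕ Fin a)
  cond : Cond

/-- A match of a rule in a host graph: an injective premorphism from the left-hand graph and a
compatible assignment such that roots are mapped to roots, the dangling condition holds, and the
application condition is satisfied. -/
structure Match (r : Rule) (G : HostGraph) where
  node : Fin r.k ⊕ Fin r.d → G.V
  edge : Fin r.lhs.m → G.E
  asg : Assignment
  node_inj : Function.Injective node
  edge_inj : Function.Injective edge
  src_eq : ∀ e, G.src (edge e) = node (r.lhs.edge e).src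
  tgt_eq : ∀ e, G.tgt (edge e) = node (r.lhs.edge e).tgt
  list_eq : ∀ v, G.list (node v) = (r.lhs.node v).list.eval asg
  mark_eq : ∀ v, (r.lhs.node v).mark.Matches (G.mark (node v))
  elist_eq : ∀ e, G.elist (edge e) = (r.lhs.edge e).list.eval asg
  emark_eq : ∀ e, G.emark (edge e) = (r.lhs.edge e).mark
  root_eq : ∀ v, (r.lhs.node v).root = true → G.root (node v)
  dangling : ∀ (d : Fin r.d) (e : G.E), e ∉ Set.range edge →
    G.src e ≠ node (Sum.inr d) ∧ G.tgt e ≠ node (Sum.inr d)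
  cond : r.cond.Holds asg

namespace Match

variable {r : Rule} {G : HostGraph} (g : Match r G)

/-- Nodes of the result: the remaining host nodes together with the added nodes. -/
abbrev ResV : Type := {v : G.V // ∀ d : Fin r.d, v ≠ g.node (Sum.inr d)} ⊕ Fin r.a

/-- Edges of the result: the remaining host edges together with the right-hand edges. -/
abbrev ResE : Type := {e : G.E // e ∉ Set.range g.edge} ⊕ Fin r.rhs.m

/-- The position in the result of a node of the right-hand graph. -/
def comatch : Fin r.k ⊕ Fin r.a → g.ResV
  | .inl k => Sum.inl ⟨g.node (Sum.inl k), fun _ h => Sum.inl_ne_inr (g.node_inj h)⟩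
  | .inr a => Sum.inr a

def resSrc : g.ResE → g.ResV
  | .inl e => Sum.inl ⟨G.src e.1, fun d => (g.dangling d e.1 e.2).1⟩
  | .inr e => g.comatch (r.rhs.edge e).src

def resTgt : g.ResE → g.ResV
  | .inl e => Sum.inl ⟨G.tgt e.1, fun d => (g.dangling d e.1 e.2).2⟩
  | .inr e => g.comatch (r.rhs.edge e).tgt

open Classical in
noncomputable def resList : g.ResV → List Atom
  | .inl v =>
    if h : ∃ k, g.node (Sum.inl k) = v.1 then
      (r.rhs.node (Sum.inl h.choose)).list.eval g.asg
    else G.list v.1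
  | .inr a => (r.rhs.node (Sum.inr a)).list.eval g.asg

open Classical in
noncomputable def resMark : g.ResV → Mark
  | .inl v =>
    if h : ∃ k, g.node (Sum.inl k) = v.1 then
      (r.rhs.node (Sum.inl h.choose)).mark.inst (G.mark v.1)
    else G.mark v.1
  | .inr a => (r.rhs.node (Sum.inr a)).mark.inst Mark.unmarked

/-- The roots of the result are the host roots that are not matched by roots of the left-hand
graph, together with the roots of the right-hand graph. -/
def resRoot : g.ResV → Prop
  | .inl v =>
    (∃ k, g.node (Sum.inl k) = v.1 ∧ (r.rhs.node (Sum.inl k)).root = true) ∨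
      (G.root v.1 ∧ ∀ k, g.node (Sum.inl k) = v.1 → (r.lhs.node (Sum.inl k)).root = false)
  | .inr a => (r.rhs.node (Sum.inr a)).root = true

def resEList : g.ResE → List Atom
  | .inl e => G.elist e.1
  | .inr e => (r.rhs.edge e).list.eval g.asg

def resEMark : g.ResE → Mark
  | .inl e => G.emark e.1
  | .inr e => (r.rhs.edge e).mark

/-- The host graph that results from applying a rule at a match. -/
noncomputable def result : HostGraph where
  V := g.ResV
  E := g.ResE
  finV := by have := G.finV; infer_instance
  finE := by have := G.finE; infer_instance
  src := g.resSrc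
  tgt := g.resTgt
  list := g.resList
  mark := g.resMark
  root := g.resRoot
  elist := g.resEList
  emark := g.resEMark

end Match

/-! ## Commands and their small-step semantics -/

/-- Command sequences: rule-set calls, sequential composition, `if`, `try`, as-long-as-possible
iteration `P!`, `skip` and `fail`. Procedure calls are macros and `break` is not included. -/
inductive Cmd
  | call (rs : List Rule)
  | seq (P Q : Cmd)
  | ite (C P Q : Cmd)
  | tryte (C P Q : Cmd)
  | loop (P : Cmd)
  | skip
  | fail

/-- Configurations: a result (a graph or failure), a command about to be executed on a graph, or a
composite command whose first component is being executed. Conditions of `if` and `try` keep the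
graph on which they were entered. -/
inductive Conf
  | graph (G : HostGraph)
  | failed
  | run (P : Cmd) (G : HostGraph)
  | seq (c : Conf) (Q : Cmd)
  | ite (c : Conf) (G : HostGraph) (P Q : Cmd)
  | tryte (c : Conf) (G : HostGraph) (P Q : Cmd)

inductive Step : Conf → Conf → Prop
  | call_apply {rs r G} (hr : r ∈ rs) (g : Match r G) :
      Step (.run (.call rs) G) (.graph g.result)
  | call_fail {rs G} (h : ∀ r ∈ rs, IsEmpty (Match r G)) :
      Step (.run (.call rs) G) .failed
  | seq_start {P Q G} : Step (.run (.seq P Q) G) (.seq (.run P G) Q)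
  | seq_step {c c' Q} (h : Step c c') : Step (.seq c Q) (.seq c' Q)
  | seq_graph {H Q} : Step (.seq (.graph H) Q) (.run Q H)
  | seq_failed {Q} : Step (.seq .failed Q) .failed
  | ite_start {C P Q G} : Step (.run (.ite C P Q) G) (.ite (.run C G) G P Q)
  | ite_step {c c' G P Q} (h : Step c c') : Step (.ite c G P Q) (.ite c' G P Q)
  | ite_graph {H G P Q} : Step (.ite (.graph H) G P Q) (.run P G)
  | ite_failed {G P Q} : Step (.ite .failed G P Q) (.run Q G)
  | try_start {C P Q G} : Step (.run (.tryte C P Q) G) (.tryte (.run C G) G P Q)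
  | try_step {c c' G P Q} (h : Step c c') : Step (.tryte c G P Q) (.tryte c' G P Q)
  | try_graph {H G P Q} : Step (.tryte (.graph H) G P Q) (.run P H)
  | try_failed {G P Q} : Step (.tryte .failed G P Q) (.run Q G)
  | loop {P G} : Step (.run (.loop P) G) (.tryte (.run P G) G (.loop P) .skip)
  | skip {G} : Step (.run .skip G) (.graph G)
  | fail {G} : Step (.run .fail G) .failed

/-- Possible outcomes of a program: an output graph, failure, or `bottom` (divergence or getting
stuck). -/
inductive Outcome
  | graph (H : HostGraph)
  | fail
  | bottom

/-- There is an infinite execution from `c`. -/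
def CanDiverge (c : Conf) : Prop :=
  ∃ f : ℕ → Conf, f 0 = c ∧ ∀ n, Step (f n) (f (n + 1))

/-- Some execution from `c` ends in a configuration that is neither a graph nor failure. -/
def CanGetStuck (c : Conf) : Prop :=
  ∃ c', Relation.ReflTransGen Step c c' ∧ (∀ c'', ¬ Step c' c'') ∧
    c' ≠ .failed ∧ ∀ H, c' ≠ .graph H

/-- The semantics of a program: the set of its possible outcomes on a host graph. -/
def sem (P : Cmd) (G : HostGraph) : Set Outcome :=
  {X | match X with
    | .graph H => Relation.ReflTransGen Step (.run P G) (.graph H)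
    | .fail => Relation.ReflTransGen Step (.run P G) .failed
    | .bottom => CanDiverge (.run P G) ∨ CanGetStuck (.run P G)}

/-! ## The rules of `bellman-ford` -/

namespace BellmanFord

/-- A non-root rule node with a given mark. -/
def plain (l : ListExpr) (m : Mark) : RuleNode := ⟨l, .exact m, false⟩

/-- A root rule node with a given mark. -/
def rooted (l : ListExpr) (m : Mark) : RuleNode := ⟨l, .exact m, true⟩

/-- A non-root rule node with the mark `any`. -/
def anyNode (l : ListExpr) : RuleNode := ⟨l, .any, false⟩

def x : ListExpr := .var .x
def y : ListExpr := .var .y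
def z : ListExpr := .var .z
def i : IntExpr := .var .i
def s : IntExpr := .var .s
def t : IntExpr := .var .t
def w : IntExpr := .var .w

/-- The list `l` with an integer appended. -/
def snocInt (l : ListExpr) (e : IntExpr) : ListExpr := .app l (.int e)

/-- The list `l` with the string `f` appended. -/
def snocF (l : ListExpr) : ListExpr := .app l (.str strF)

/-- A rule relabelling a single node. -/
def nodeRule (p q : RuleNode) (c : Cond) : Rule where
  k := 1
  d := 0
  a := 0
  lhs := ⟨Sum.elim ![p] ![], 0, ![]⟩
  rhs := ⟨Sum.elim ![q] ![], 0, ![]⟩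
  cond := c

/-- A rule for an edge, with label `l`, from a blue root with label `p` to a node with the mark
`any` and label `q`: the label of the target becomes `q'` and the mark of the edge changes from `m`
to `m'`. -/
def edgeRule (p q q' l : ListExpr) (m m' : Mark) (c : Cond) : Rule where
  k := 2
  d := 0
  a := 0
  lhs := ⟨Sum.elim ![rooted p .blue, anyNode q] ![], 1, ![⟨.inl 0, .inl 1, l, m⟩]⟩
  rhs := ⟨Sum.elim ![rooted p .blue, anyNode q'] ![], 1, ![⟨.inl 0, .inl 1, l, m'⟩]⟩
  cond := c

def set_counter : Rule where
  k := 1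
  d := 0
  a := 1
  lhs := ⟨Sum.elim ![rooted x .grey] ![], 0, ![]⟩
  rhs := ⟨Sum.elim ![plain (snocInt x (.const 0)) .blue] ![plain (.int (.const 0)) .green],
    1, ![⟨.inr 0, .inl 0, .empty, .dashed⟩]⟩
  cond := .always

def count : Rule where
  k := 2
  d := 0
  a := 0
  lhs := ⟨Sum.elim ![plain x .grey, plain (.int i) .green] ![], 0, ![]⟩
  rhs := ⟨Sum.elim ![plain (snocF x) .blue, plain (.int (.add i (.const 1))) .green] ![], 0, ![]⟩
  cond := .always

def root1 : Rule := nodeRule (plain x .blue) (rooted x .blue) .always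

/-- The node is deleted and re-created, so that the rule applies to isolated nodes only. -/
def no_deg : Rule where
  k := 0
  d := 1
  a := 1
  lhs := ⟨Sum.elim ![] ![rooted x .blue], 0, ![]⟩
  rhs := ⟨Sum.elim ![] ![plain x .unmarked], 0, ![]⟩
  cond := .always

def unroot1 : Rule := nodeRule (rooted x .blue) (plain x .grey) .always

def decrement : Rule :=
  nodeRule (plain (.int i) .green) (plain (.int (.sub i (.const 1))) .green) (.gt i (.const 0))

def unmarked_edge : Rule := edgeRule x y y z .unmarked .red .always

def unmark_edge : Rule := edgeRule x y y z .blue .unmarked .always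

def no_deg_inv : Rule := nodeRule (plain x .unmarked) (plain x .grey) .always

def unvisited : Rule :=
  edgeRule (snocInt x s) (snocF y) (snocInt y (.add s w)) (.int w) .red .red .always

def root2 : Rule := nodeRule (plain x .grey) (rooted x .blue) .always

def reduce : Rule :=
  edgeRule (snocInt x s) (snocInt y t) (snocInt y (.add s w)) (.int w) .red .red
    (.lt (.add s w) t)

def unroot2 : Rule := nodeRule (rooted x .blue) (plain x .blue) .always

def finish : Rule := edgeRule x y y z .red .blue .always

def set_flag : Rule := nodeRule (plain x .green) (plain (.int (.const (-1))) .green) .always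

/-- Deletes the counter node and returns the root to the source node, which is grey when this rule
is called. -/
def delete_counter : Rule where
  k := 1
  d := 1
  a := 0
  lhs := ⟨Sum.elim ![plain x .grey] ![plain y .green], 1, ![⟨.inr 0, .inl 0, .empty, .dashed⟩]⟩
  rhs := ⟨Sum.elim ![rooted x .grey] ![], 0, ![]⟩
  cond := .always

def flag : Rule :=
  nodeRule (plain (.int (.const (-1))) .green) (plain (.int (.const (-1))) .green) .always

/-! ## The program -/

/-- The call of a single rule. -/
def rule (r : Rule) : Cmd := .call [r]

/-- `Relax = root1; try no_deg
               else ((unmarked_edge; try {unvisited, reduce}; finish)!; unroot1)` -/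
def Relax : Cmd :=
  .seq (rule root1)
    (.tryte (rule no_deg) .skip
      (.seq
        (.loop (.seq (rule unmarked_edge)
          (.seq (.tryte (.call [unvisited, reduce]) .skip .skip) (rule finish))))
        (rule unroot1)))

/-- `Clean = root2; unmark_edge!; unroot2` -/
def Clean : Cmd :=
  .seq (rule root2) (.seq (.loop (rule unmark_edge)) (rule unroot2))

/-- `Final = (root1; (unmarked_edge; if reduce then set_flag; finish)!; unroot1)!;
        if flag then fail; delete_counter; no_deg_inv!` -/
def Final : Cmd :=
  .seq
    (.loop (.seq (rule root1) (.seq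
      (.loop (.seq (rule unmarked_edge)
        (.seq (.ite (rule reduce) (rule set_flag) .skip) (rule finish))))
      (rule unroot1))))
    (.seq (.ite (rule flag) .fail .skip)
      (.seq (rule delete_counter) (.loop (rule no_deg_inv))))

/-- `Main = set_counter; count!; (decrement; Relax!; Clean!)!; Final` -/
def program : Cmd :=
  .seq (rule set_counter) (.seq (.loop (rule count))
    (.seq (.loop (.seq (rule decrement) (.seq (.loop Relax) (.loop Clean)))) Final))

end BellmanFord

/-! ## Specification -/

namespace HostGraph

/-- `es` is the edge sequence of a directed path from `u` to `v` (nodes may be revisited). -/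
def IsPath (G : HostGraph) : G.V → List G.E → G.V → Prop
  | u, [], v => u = v
  | u, e :: es, v => G.src e = u ∧ G.IsPath (G.tgt e) es v

/-- The integer labelling an edge (and 0 if the label is not a single integer). -/
def weight (G : HostGraph) (e : G.E) : ℤ :=
  match G.elist e with
  | [Atom.int w] => w
  | _ => 0

/-- The sum of the edge labels along a path. -/
def pathWeight (G : HostGraph) (es : List G.E) : ℤ := (es.map G.weight).sum

def Reachable (G : HostGraph) (u v : G.V) : Prop := ∃ es, G.IsPath u es v

/-- `es` is a directed cycle through `v`: a non-empty closed path that visits no node twice. -/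
def IsCycle (G : HostGraph) (v : G.V) (es : List G.E) : Prop :=
  es ≠ [] ∧ G.IsPath v es v ∧ (es.map G.src).Nodup

/-- A directed cycle whose sum of edge labels is negative is reachable from `r`. -/
def HasNegCycleFrom (G : HostGraph) (r : G.V) : Prop :=
  ∃ v es, G.Reachable r v ∧ G.IsCycle v es ∧ G.pathWeight es < 0

/-- `d` is the shortest distance from `u` to `v`: the least weight of a directed path. -/
def IsDist (G : HostGraph) (u v : G.V) (d : ℤ) : Prop :=
  IsLeast {c | ∃ es, G.IsPath u es v ∧ G.pathWeight es = c} d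

end HostGraph

namespace BellmanFord

/-- The input graphs of the program. -/
structure IsInput (G : HostGraph) : Prop where
  grey : ∀ v, G.mark v = Mark.grey
  root : ∃! r, G.root r
  edges : ∀ e, G.emark e = Mark.unmarked ∧ ∃ w : ℤ, G.elist e = [Atom.int w]
  no_loops : ∀ e, G.src e ≠ G.tgt e

/-- `H` is, up to isomorphism, obtained from `G` by appending to the label of each node its shortest
distance from `r` if it is reachable from `r`, and the string `f` otherwise, and marking all edges
blue. Everything else (node marks, roots, edge lists) is unchanged. -/
def IsOutput (G : HostGraph) (r : G.V) (H : HostGraph) : Prop :=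
  ∃ (φ : G.V ≃ H.V) (ψ : G.E ≃ H.E),
    (∀ e, H.src (ψ e) = φ (G.src e)) ∧
    (∀ e, H.tgt (ψ e) = φ (G.tgt e)) ∧
    (∀ e, H.elist (ψ e) = G.elist e) ∧
    (∀ e, H.emark (ψ e) = Mark.blue) ∧
    (∀ v, H.mark (φ v) = G.mark v) ∧
    (∀ v, H.root (φ v) ↔ G.root v) ∧
    (∀ v, G.Reachable r v →
      ∃ d, G.IsDist r v d ∧ H.list (φ v) = G.list v ++ [Atom.int d]) ∧
    (∀ v, ¬ G.Reachable r v → H.list (φ v) = G.list v ++ [Atom.str strF])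

end BellmanFord

end GP2

/-! The program is the Bellman–Ford algorithm: counting sets the counter to |V| - 1, each round
relaxes every edge once, and the final phase asks whether some edge can still be relaxed. Tentative
distances `d` take values in ℤ ∪ {∞}, where ∞ is displayed as the string "f". Two invariants carry
the mathematics. Every finite `d v` is the weight of some path from `r` to `v` (`Attained`), and
after `k` rounds `d v` is at most the weight of every such path with at most `k` edges
(`BoundedBy`). A round raises `k` by one whatever the order of the edges, because values only
decrease, so each relaxation is at least as good as one that uses the source value from the start of
the round.

Cutting out cycles turns any path into one with fewer than |V| edges, and its weight does not grow
unless a negative cycle is cut out (`IsPath.exists_short`). Hence after |V| - 1 rounds every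
reachable node has a finite value. Without a reachable negative cycle these values are the
distances, and no edge can be relaxed. With one, summing the inequalities "not relaxable" around the
cycle would make its weight non-negative, so some edge can be relaxed (`exists_reducible_iff`).

The rest ties the program to this argument. `Good` is a total-correctness judgement covering all
executions, with proof rules for each command; loops need an invariant and a variant. Up to
isomorphism every rule except `set_counter` and `delete_counter` only relabels a fixed shape, since
`no_deg` recreates the node it deletes (`Match.exists_appliesAt`). The main part is therefore
tracked on abstract states `St`. Marks record progress: outside the node being processed, blue nodes
have unmarked outgoing edges and grey nodes have blue ones (`Swept`, `Active`). Loop variants count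
marks, except in the main loop, where the counter decreases. -/

namespace GP2

/-! ## A total-correctness logic for commands -/

/-- Every execution from the configuration terminates, without getting stuck, either in a graph
satisfying `Q` or in failure, and the latter only if `F` holds. -/
inductive Good (Q : HostGraph → Prop) (F : Prop) : Conf → Prop
  | graph {H} (h : Q H) : Good Q F (.graph H)
  | failed (h : F) : Good Q F .failed
  | step {c} (h : ∃ c', Step c c') (h' : ∀ c', Step c c' → Good Q F c') : Good Q F c

namespace Good

variable {Q Q' : HostGraph → Prop} {F F' : Prop}

theorem mono {c : Conf} (h : Good Q' F' c) (hQ : ∀ H, Q' H → Q H) (hF : F' → F) :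
    Good Q F c := by
  induction h with
  | graph h => exact .graph (hQ _ h)
  | failed h => exact .failed (hF h)
  | step h _ ih => exact .step h ih

/-- A call never gets stuck: either some rule of the set has a match, or all lack one and the call
fails. -/
theorem call {rs : List Rule} {G : HostGraph} (h : ∀ r ∈ rs, ∀ g : Match r G, Q g.result)
    (hF : (∀ r ∈ rs, IsEmpty (Match r G)) → F) : Good Q F (.run (.call rs) G) := by
  refine .step ?_ ?_
  · by_cases hr : ∀ r ∈ rs, IsEmpty (Match r G)
    · exact ⟨_, .call_fail hr⟩
    · push Not at hr
      obtain ⟨r, hr, hg⟩ := hr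
      exact ⟨_, .call_apply hr hg.some⟩
  · intro c' hc
    cases hc with
    | call_apply hr g => exact .graph (h _ hr g)
    | call_fail h => exact .failed (hF h)

theorem skip {G : HostGraph} (h : Q G) : Good Q F (.run .skip G) :=
  .step ⟨_, .skip⟩ fun _ hc => by cases hc; exact .graph h

theorem fail {G : HostGraph} (h : F) : Good Q F (.run .fail G) :=
  .step ⟨_, .fail⟩ fun _ hc => by cases hc; exact .failed h

theorem seqConf {c : Conf} {P : Cmd} (h : Good Q' F c)
    (h' : ∀ H, Q' H → Good Q F (.run P H)) : Good Q F (.seq c P) := by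
  induction h with
  | graph h =>
    refine .step ⟨_, .seq_graph⟩ fun _ hc => ?_
    cases hc with
    | seq_step h => cases h
    | seq_graph => exact h' _ h
  | failed h =>
    refine .step ⟨_, .seq_failed⟩ fun _ hc => ?_
    cases hc with
    | seq_step h => cases h
    | seq_failed => exact .failed h
  | step h _ ih =>
    obtain ⟨c', hc'⟩ := h
    refine .step ⟨_, .seq_step hc'⟩ fun _ hc => ?_
    cases hc with
    | seq_step h => exact ih _ h
    | seq_graph => cases hc'
    | seq_failed => cases hc'

theorem seq {P P' : Cmd} {G : HostGraph} (h : Good Q' F (.run P G))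
    (h' : ∀ H, Q' H → Good Q F (.run P' H)) : Good Q F (.run (.seq P P') G) :=
  .step ⟨_, .seq_start⟩ fun _ hc => by cases hc; exact seqConf h h'

/-- The obligations for the two branches serve as postcondition and failure condition of the test,
in weakest-precondition style. The graph produced by the test is ignored, since both branches start
from `G`. -/
theorem iteConf {c : Conf} {P P' : Cmd} {G : HostGraph}
    (h : Good (fun _ => Good Q F (.run P G)) (Good Q F (.run P' G)) c) :
    Good Q F (.ite c G P P') := by
  induction h with
  | graph h =>
    refine .step ⟨_, .ite_graph⟩ fun _ hc => ?_
    cases hc with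
    | ite_step h => cases h
    | ite_graph => exact h
  | failed h =>
    refine .step ⟨_, .ite_failed⟩ fun _ hc => ?_
    cases hc with
    | ite_step h => cases h
    | ite_failed => exact h
  | step h _ ih =>
    obtain ⟨c', hc'⟩ := h
    refine .step ⟨_, .ite_step hc'⟩ fun _ hc => ?_
    cases hc with
    | ite_step h => exact ih _ h
    | ite_graph => cases hc'
    | ite_failed => cases hc'

theorem ite {C P P' : Cmd} {G : HostGraph}
    (h : Good (fun _ => Good Q F (.run P G)) (Good Q F (.run P' G)) (.run C G)) :
    Good Q F (.run (.ite C P P') G) :=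
  .step ⟨_, .ite_start⟩ fun _ hc => by cases hc; exact iteConf h

/-- As for `if`, except that the success branch continues on the graph produced by the test. -/
theorem tryteConf {c : Conf} {P P' : Cmd} {G : HostGraph}
    (h : Good (fun H => Good Q F (.run P H)) (Good Q F (.run P' G)) c) :
    Good Q F (.tryte c G P P') := by
  induction h with
  | graph h =>
    refine .step ⟨_, .try_graph⟩ fun _ hc => ?_
    cases hc with
    | try_step h => cases h
    | try_graph => exact h
  | failed h =>
    refine .step ⟨_, .try_failed⟩ fun _ hc => ?_
    cases hc with
    | try_step h => cases h
    | try_failed => exact h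
  | step h _ ih =>
    obtain ⟨c', hc'⟩ := h
    refine .step ⟨_, .try_step hc'⟩ fun _ hc => ?_
    cases hc with
    | try_step h => exact ih _ h
    | try_graph => cases hc'
    | try_failed => cases hc'

theorem tryte {C P P' : Cmd} {G : HostGraph}
    (h : Good (fun H => Good Q F (.run P H)) (Good Q F (.run P' G)) (.run C G)) :
    Good Q F (.run (.tryte C P P') G) :=
  .step ⟨_, .try_start⟩ fun _ hc => by cases hc; exact tryteConf h

/-- A loop with invariant `I`, indexed by abstract states, and variant `μ`. -/
theorem loop {A : Type*} (I : A → HostGraph → Prop) (μ : A → ℕ) {P : Cmd}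
    (h : ∀ a H, I a H → Good (fun H' => ∃ a', μ a' < μ a ∧ I a' H') (Q H) (.run P H))
    {a : A} {H : HostGraph} (ha : I a H) : Good Q F (.run (.loop P) H) := by
  induction hn : μ a using Nat.strong_induction_on generalizing a H with
  | _ n ih =>
    subst hn
    refine .step ⟨_, .loop⟩ fun _ hc => ?_
    cases hc
    -- Failure of the body ends the loop with its entry graph, so the failure condition of the body
    -- is `Q H`; the loop itself cannot fail.
    refine tryteConf ((h a H ha).mono ?_ Good.skip)
    rintro H' ⟨a', hlt, ha'⟩
    exact ih _ hlt ha' rfl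

theorem reaches {c c' : Conf} (h : Good Q F c) (hc : Relation.ReflTransGen Step c c') :
    Good Q F c' := by
  induction hc with
  | refl => exact h
  | tail _ hs ih =>
    cases ih with
    | graph => cases hs
    | failed => cases hs
    | step _ ih => exact ih _ hs

/-- A derivation of `Good` is a well-founded tree of executions, down which an infinite execution
would descend forever. -/
theorem not_canDiverge {c : Conf} (h : Good Q F c) : ¬ CanDiverge c := by
  induction h with
  | graph h => rintro ⟨f, h0, hf⟩; have := hf 0; rw [h0] at this; cases this
  | failed h => rintro ⟨f, h0, hf⟩; have := hf 0; rw [h0] at this; cases this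
  | step _ _ ih =>
    rintro ⟨f, h0, hf⟩
    exact ih (f 1) (h0 ▸ hf 0) ⟨fun n => f (n + 1), rfl, fun n => hf (n + 1)⟩

theorem not_canGetStuck {c : Conf} (h : Good Q F c) : ¬ CanGetStuck c := by
  rintro ⟨c', hc, hn, hf, hg⟩
  cases h.reaches hc with
  | graph => exact hg _ rfl
  | failed => exact hf rfl
  | step h => exact hn _ h.choose_spec

theorem exists_outcome {c : Conf} (h : Good Q F c) :
    (∃ H, Relation.ReflTransGen Step c (.graph H)) ∨ Relation.ReflTransGen Step c .failed := by
  induction h with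
  | graph h => exact .inl ⟨_, .refl⟩
  | failed h => exact .inr .refl
  | step h _ ih =>
    obtain ⟨c', hc⟩ := h
    rcases ih _ hc with ⟨H, hH⟩ | hf
    · exact .inl ⟨H, hH.head hc⟩
    · exact .inr (hf.head hc)

theorem bottom_notMem_sem {P : Cmd} {G : HostGraph} (h : Good Q F (.run P G)) :
    Outcome.bottom ∉ sem P G := by
  rintro (hd | hs)
  · exact h.not_canDiverge hd
  · exact h.not_canGetStuck hs

theorem sem_nonempty {P : Cmd} {G : HostGraph} (h : Good Q F (.run P G)) :
    (sem P G).Nonempty := by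
  rcases h.exists_outcome with ⟨H, hH⟩ | hf
  · exact ⟨.graph H, hH⟩
  · exact ⟨.fail, hf⟩

theorem of_mem_sem {P : Cmd} {G : HostGraph} (h : Good Q F (.run P G)) {X : Outcome}
    (hX : X ∈ sem P G) : (∃ H, X = .graph H ∧ Q H) ∨ X = .fail ∧ F := by
  cases X with
  | graph H =>
    cases h.reaches hX with
    | graph h => exact .inl ⟨H, rfl, h⟩
    | step h => obtain ⟨_, h⟩ := h; cases h
  | fail =>
    cases h.reaches hX with
    | failed h => exact .inr ⟨rfl, h⟩
    | step h => obtain ⟨_, h⟩ := h; cases h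
  | bottom => exact absurd hX h.bottom_notMem_sem

end Good

/-! ## Host graphs up to isomorphism -/

/-- The part of a host graph that is preserved by relabelling rules. -/
structure Shape where
  V : Type
  E : Type
  src : E → V
  tgt : E → V
  elist : E → List Atom

/-- The part of a host graph that is changed by relabelling rules. -/
structure Labelling (S : Shape) where
  list : S.V → List Atom
  mark : S.V → Mark
  root : S.V → Prop
  emark : S.E → Mark

/-- The host graph `H` is the shape `S` with labelling `σ`, up to the given bijections. -/
structure RepBy (S : Shape) (σ : Labelling S) (H : HostGraph) (φ : S.V ≃ H.V) (ψ : S.E ≃ H.E) :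
    Prop where
  src : ∀ e, H.src (ψ e) = φ (S.src e)
  tgt : ∀ e, H.tgt (ψ e) = φ (S.tgt e)
  elist : ∀ e, H.elist (ψ e) = S.elist e
  list : ∀ v, H.list (φ v) = σ.list v
  mark : ∀ v, H.mark (φ v) = σ.mark v
  root : ∀ v, H.root (φ v) ↔ σ.root v
  emark : ∀ e, H.emark (ψ e) = σ.emark e

def Rep (S : Shape) (σ : Labelling S) (H : HostGraph) : Prop :=
  ∃ φ ψ, RepBy S σ H φ ψ

/-! ## Rules that relabel or replace nodes -/

namespace Match

variable {r : Rule} {G : HostGraph} (g : Match r G)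

/-- Injectivity of the match forces the index chosen in `resList` to be `k`. -/
theorem resList_inl (k : Fin r.k) (h) :
    g.resList (.inl ⟨g.node (.inl k), h⟩) = (r.rhs.node (.inl k)).list.eval g.asg := by
  have hk : ∃ k', g.node (.inl k') = g.node (.inl k) := ⟨k, rfl⟩
  have : hk.choose = k := Sum.inl_injective (g.node_inj hk.choose_spec)
  simp only [resList, dif_pos hk, this]

theorem resList_of_ne (v) (h : ∀ k, g.node (.inl k) ≠ v.1) :
    g.resList (.inl v) = G.list v.1 :=
  dif_neg (by simpa using h)

theorem resMark_inl (k : Fin r.k) (h) :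
    g.resMark (.inl ⟨g.node (.inl k), h⟩) =
      (r.rhs.node (.inl k)).mark.inst (G.mark (g.node (.inl k))) := by
  have hk : ∃ k', g.node (.inl k') = g.node (.inl k) := ⟨k, rfl⟩
  have : hk.choose = k := Sum.inl_injective (g.node_inj hk.choose_spec)
  simp only [resMark, dif_pos hk, this]

theorem resMark_of_ne (v) (h : ∀ k, g.node (.inl k) ≠ v.1) :
    g.resMark (.inl v) = G.mark v.1 :=
  dif_neg (by simpa using h)

theorem resRoot_inl (k : Fin r.k) (h) :
    g.resRoot (.inl ⟨g.node (.inl k), h⟩) ↔ (r.rhs.node (.inl k)).root = true ∨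
      G.root (g.node (.inl k)) ∧ (r.lhs.node (.inl k)).root = false := by
  have key : ∀ k', g.node (.inl k') = g.node (.inl k) ↔ k' = k := fun k' =>
    ⟨fun h => Sum.inl_injective (g.node_inj h), fun h => h ▸ rfl⟩
  simp [resRoot, key]

theorem resRoot_of_ne (v) (h : ∀ k, g.node (.inl k) ≠ v.1) :
    g.resRoot (.inl v) ↔ G.root v.1 := by
  simp [resRoot, h]

end Match

/-- Rules that keep `k` nodes, replace `d` nodes by new ones and relabel edges. -/
abbrev swapRule (k d m : ℕ) (p q : Fin k ⊕ Fin d → RuleNode)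
    (e e' : Fin m → RuleEdge (Fin k ⊕ Fin d)) (c : Cond) : Rule :=
  ⟨k, d, d, ⟨p, m, e⟩, ⟨q, m, e'⟩, c⟩

/-- The left-hand side of a rule of the form `swapRule` occurs at the given nodes and edges. -/
structure AppliesAt {S : Shape} (σ : Labelling S) {k d m : ℕ} (p : Fin k ⊕ Fin d → RuleNode)
    (e : Fin m → RuleEdge (Fin k ⊕ Fin d)) (c : Cond)
    (n : Fin k ⊕ Fin d → S.V) (ed : Fin m → S.E) (α : Assignment) : Prop where
  node_inj : Function.Injective n
  edge_inj : Function.Injective ed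
  src : ∀ i, S.src (ed i) = n (e i).src
  tgt : ∀ i, S.tgt (ed i) = n (e i).tgt
  list : ∀ j, σ.list (n j) = (p j).list.eval α
  mark : ∀ j, (p j).mark.Matches (σ.mark (n j))
  elist : ∀ i, S.elist (ed i) = (e i).list.eval α
  emark : ∀ i, σ.emark (ed i) = (e i).mark
  root : ∀ j, (p j).root = true → σ.root (n j)
  dangling : ∀ (j : Fin d) (f : S.E), f ∉ Set.range ed →
    S.src f ≠ n (.inr j) ∧ S.tgt f ≠ n (.inr j)
  cond : c.Holds α

/-- `σ'` results from `σ` by a rule of the form `swapRule`. -/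
structure Updated {S : Shape} (σ : Labelling S) {k d m : ℕ} (p q : Fin k ⊕ Fin d → RuleNode)
    (e' : Fin m → RuleEdge (Fin k ⊕ Fin d))
    (n : Fin k ⊕ Fin d → S.V) (ed : Fin m → S.E) (α : Assignment) (σ' : Labelling S) : Prop where
  list : ∀ j, σ'.list (n j) = (q j).list.eval α
  list_of_ne : ∀ v, (∀ j, v ≠ n j) → σ'.list v = σ.list v
  mark_inl : ∀ j, σ'.mark (n (.inl j)) = (q (.inl j)).mark.inst (σ.mark (n (.inl j)))
  mark_inr : ∀ j, σ'.mark (n (.inr j)) = (q (.inr j)).mark.inst .unmarked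
  mark_of_ne : ∀ v, (∀ j, v ≠ n j) → σ'.mark v = σ.mark v
  root_inl : ∀ j, σ'.root (n (.inl j)) ↔
    (q (.inl j)).root = true ∨ σ.root (n (.inl j)) ∧ (p (.inl j)).root = false
  root_inr : ∀ j, σ'.root (n (.inr j)) ↔ (q (.inr j)).root = true
  root_of_ne : ∀ v, (∀ j, v ≠ n j) → (σ'.root v ↔ σ.root v)
  emark : ∀ i, σ'.emark (ed i) = (e' i).mark
  emark_of_ne : ∀ f, (∀ i, f ≠ ed i) → σ'.emark f = σ.emark f

section swapRule

variable {S : Shape} {σ : Labelling S} {H : HostGraph} {k d m : ℕ}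
  {p q : Fin k ⊕ Fin d → RuleNode} {e e' : Fin m → RuleEdge (Fin k ⊕ Fin d)} {c : Cond}

theorem AppliesAt.exists_match (hR : Rep S σ H) {n ed α} (h : AppliesAt σ p e c n ed α) :
    Nonempty (Match (swapRule k d m p q e e' c) H) := by
  obtain ⟨φ, ψ, hR⟩ := hR
  refine ⟨⟨fun j => φ (n j), fun i => ψ (ed i), α, φ.injective.comp h.node_inj,
    ψ.injective.comp h.edge_inj, fun i => ?_, fun i => ?_, fun j => ?_, fun j => ?_,
    fun i => ?_, fun i => ?_, fun j hj => ?_, fun j f hf => ?_, h.cond⟩⟩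
  · exact (hR.src _).trans (congrArg φ (h.src i))
  · exact (hR.tgt _).trans (congrArg φ (h.tgt i))
  · exact (hR.list _).trans (h.list j)
  · rw [hR.mark]; exact h.mark j
  · exact (hR.elist _).trans (h.elist i)
  · exact (hR.emark _).trans (h.emark i)
  · exact (hR.root _).2 (h.root j hj)
  · obtain ⟨f, rfl⟩ := ψ.surjective f
    have := h.dangling j f fun ⟨i, hi⟩ => hf ⟨i, congrArg ψ hi⟩
    rw [hR.src, hR.tgt]
    exact ⟨fun h => this.1 (φ.injective h), fun h => this.2 (φ.injective h)⟩

/-- The rule creates as many nodes and edges as it deletes, with the same incidences and edge lists,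
so its result is again the shape `S` up to isomorphism. The result is specified only as a
representation of every labelling that satisfies `Updated`; later proofs supply a convenient one. -/
theorem Match.exists_appliesAt (hR : Rep S σ H)
    (hsrc : ∀ i, (e i).src = (e' i).src) (htgt : ∀ i, (e i).tgt = (e' i).tgt)
    (hlist : ∀ i, (e i).list = (e' i).list)
    (g : Match (swapRule k d m p q e e' c) H) :
    ∃ n ed α, AppliesAt σ p e c n ed α ∧
      ∀ σ', Updated σ p q e' n ed α σ' → Rep S σ' g.result := by
  obtain ⟨φ, ψ, hR⟩ := hR
  have hn : ∀ j, φ (φ.symm (g.node j)) = g.node j := fun j => φ.apply_symm_apply _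
  have he : ∀ i, ψ (ψ.symm (g.edge i)) = g.edge i := fun j => ψ.apply_symm_apply _
  refine ⟨fun j => φ.symm (g.node j), fun i => ψ.symm (g.edge i), g.asg,
    ⟨φ.symm.injective.comp g.node_inj, ψ.symm.injective.comp g.edge_inj, fun i => ?_, fun i => ?_,
      fun j => ?_, fun j => ?_, fun i => ?_, fun i => ?_, fun j hj => ?_, fun j f hf => ?_, g.cond⟩,
    fun σ' h => ?_⟩
  · apply φ.injective; rw [← hR.src, he, hn]; exact g.src_eq i
  · apply φ.injective; rw [← hR.tgt, he, hn]; exact g.tgt_eq i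
  · rw [← hR.list, hn]; exact g.list_eq j
  · rw [← hR.mark, hn]; exact g.mark_eq j
  · rw [← hR.elist, he]; exact g.elist_eq i
  · rw [← hR.emark, he]; exact g.emark_eq i
  · rw [← hR.root, hn]; exact g.root_eq j hj
  · have := g.dangling j (ψ f) fun ⟨i, hi⟩ => hf ⟨i, by simp [hi]⟩
    rw [hR.src, hR.tgt] at this
    exact ⟨fun h => this.1 (by rw [h, hn]), fun h => this.2 (by rw [h, hn])⟩
  -- The nodes and edges of the result are identified with those of `H`: each added item takes the
  -- place of the deleted item with the same index.
  · let fV : g.ResV → H.V := Sum.elim (fun v => v.1) fun j => g.node (.inr j)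
    let fE : g.ResE → H.E := Sum.elim (fun f => f.1) g.edge
    have hV : Function.Bijective fV := by
      constructor
      · rintro (⟨v, hv⟩ | j) (⟨v', hv'⟩ | j') hvv
        · exact congrArg _ (Subtype.ext hvv)
        · exact absurd hvv (hv j')
        · exact absurd hvv.symm (hv' j)
        · exact congrArg _ (Sum.inr_injective (g.node_inj hvv))
      · intro v
        by_cases hv : ∃ j, g.node (.inr j) = v
        · obtain ⟨j, rfl⟩ := hv; exact ⟨.inr j, rfl⟩
        · exact ⟨.inl ⟨v, fun j hj => hv ⟨j, hj.symm⟩⟩, rfl⟩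
    have hE : Function.Bijective fE := by
      constructor
      · rintro (⟨v, hv⟩ | j) (⟨v', hv'⟩ | j') hvv
        · exact congrArg _ (Subtype.ext hvv)
        · exact absurd ⟨j', hvv.symm⟩ hv
        · exact absurd ⟨j, hvv⟩ hv'
        · exact congrArg _ (g.edge_inj hvv)
      · intro f
        by_cases hf : ∃ i, g.edge i = f
        · obtain ⟨i, rfl⟩ := hf; exact ⟨.inr i, rfl⟩
        · exact ⟨.inl ⟨f, hf⟩, rfl⟩
    have hco : ∀ j, fV (g.comatch j) = g.node j := by rintro (j | j) <;> rfl
    let ΦV := Equiv.ofBijective fV hV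
    let ΦE := Equiv.ofBijective fE hE
    -- A node of the result is kept and matched, newly added, or outside the occurrence; these three
    -- cases correspond to the clauses of `Updated`.
    have vcase : ∀ (P : S.V → g.ResV → Prop),
        (∀ j h, P (φ.symm (g.node (.inl j))) (.inl ⟨g.node (.inl j), h⟩)) →
        (∀ j, P (φ.symm (g.node (.inr j))) (.inr j)) →
        (∀ v h, (∀ j, φ v ≠ g.node j) → P v (.inl ⟨φ v, h⟩)) → ∀ v, P v (ΦV.symm (φ v)) := by
      intro P h1 h2 h3 v
      obtain ⟨u, hu⟩ : ∃ u, ΦV.symm (φ v) = u := ⟨_, rfl⟩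
      rw [hu]
      obtain rfl : φ.symm (ΦV u) = v := by rw [← hu]; simp
      rcases u with ⟨u, hu'⟩ | j
      · by_cases hk : ∃ j, g.node (.inl j) = u
        · obtain ⟨j, rfl⟩ := hk; exact h1 j _
        · have := h3 (φ.symm u) (by rwa [φ.apply_symm_apply]) (by
            rw [φ.apply_symm_apply]
            rintro (j | j) rfl
            · exact hk ⟨j, rfl⟩
            · exact hu' j rfl)
          simp only [φ.apply_symm_apply] at this; exact this
      · exact h2 j
    have ecase : ∀ (P : S.E → g.ResE → Prop),
        (∀ i, P (ψ.symm (g.edge i)) (.inr i)) →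
        (∀ f h, (∀ i, ψ f ≠ g.edge i) → P f (.inl ⟨ψ f, h⟩)) → ∀ f, P f (ΦE.symm (ψ f)) := by
      intro P h1 h2 f
      obtain ⟨u, hu⟩ : ∃ u, ΦE.symm (ψ f) = u := ⟨_, rfl⟩
      rw [hu]
      obtain rfl : ψ.symm (ΦE u) = f := by rw [← hu]; simp
      rcases u with ⟨u, hu'⟩ | j
      · have := h2 (ψ.symm u) (by rwa [ψ.apply_symm_apply]) (by
          rw [ψ.apply_symm_apply]
          rintro i rfl
          exact hu' ⟨i, rfl⟩)
        simp only [ψ.apply_symm_apply] at this; exact this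
      · exact h1 j
    have hne : ∀ v, (∀ j, φ v ≠ g.node j) → ∀ j, v ≠ φ.symm (g.node j) :=
      fun v hv j hj => hv j (by rw [hj, hn])
    have hene : ∀ f, (∀ i, ψ f ≠ g.edge i) → ∀ i, f ≠ ψ.symm (g.edge i) :=
      fun v hv j hj => hv j (by rw [hj, he])
    refine ⟨φ.trans ΦV.symm, ψ.trans ΦE.symm, ?_, ?_, ?_, ?_, ?_, ?_, ?_⟩
    · refine ecase (fun f u => g.resSrc u = ΦV.symm (φ (S.src f))) (fun i => ?_) fun f h hf => ?_
      · rw [Equiv.eq_symm_apply, ← hR.src, he]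
        refine (hco _).trans ?_
        rw [g.src_eq i]; exact congrArg g.node (hsrc i).symm
      · rw [Equiv.eq_symm_apply]; exact hR.src f
    · refine ecase (fun f u => g.resTgt u = ΦV.symm (φ (S.tgt f))) (fun i => ?_) fun f h hf => ?_
      · rw [Equiv.eq_symm_apply, ← hR.tgt, he]
        refine (hco _).trans ?_
        rw [g.tgt_eq i]; exact congrArg g.node (htgt i).symm
      · rw [Equiv.eq_symm_apply]; exact hR.tgt f
    · refine ecase (fun f u => g.resEList u = S.elist f) (fun i => ?_) fun f h hf => ?_
      · rw [← hR.elist, he, g.elist_eq i]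
        exact congrArg (ListExpr.eval g.asg) (hlist i).symm
      · exact hR.elist f
    · refine vcase (fun v u => g.resList u = σ'.list v) (fun j h' => ?_) (fun j => ?_)
        fun v h' hv => ?_
      · exact (g.resList_inl j _).trans (h.list (.inl j)).symm
      · exact (h.list (.inr j)).symm
      · rw [h.list_of_ne v (hne v hv), g.resList_of_ne _ fun j hj => hv _ hj.symm]
        exact hR.list v
    · refine vcase (fun v u => g.resMark u = σ'.mark v) (fun j h' => ?_) (fun j => ?_)
        fun v h' hv => ?_
      · refine (g.resMark_inl j _).trans ((h.mark_inl j).trans ?_).symm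
        rw [← hR.mark, hn]
      · exact (h.mark_inr j).symm
      · rw [h.mark_of_ne v (hne v hv), g.resMark_of_ne _ fun j hj => hv _ hj.symm]
        exact hR.mark v
    · refine vcase (fun v u => g.resRoot u ↔ σ'.root v) (fun j h' => ?_) (fun j => ?_)
        fun v h' hv => ?_
      · refine (g.resRoot_inl j _).trans ((h.root_inl j).trans ?_).symm
        rw [← hR.root, hn]
      · exact (h.root_inr j).symm
      · rw [h.root_of_ne v (hne v hv), g.resRoot_of_ne _ fun j hj => hv _ hj.symm]
        exact hR.root v
    · refine ecase (fun f u => g.resEMark u = σ'.emark f) (fun i => ?_) fun f h' hf => ?_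
      · exact (h.emark i).symm
      · rw [h.emark_of_ne f (hene f hf)]
        exact hR.emark f

end swapRule

/-! ### The individual rules as operations on labellings -/

namespace BellmanFord

section rules

variable {S : Shape} {σ : Labelling S} {H : HostGraph} {Q : HostGraph → Prop} {F : Prop}

/-- The occurrences of a node rule. -/
structure NodeOcc (σ : Labelling S) (p : RuleNode) (c : Cond) (v : S.V) (α : Assignment) :
    Prop where
  list : σ.list v = p.list.eval α
  mark : p.mark.Matches (σ.mark v)
  root : p.root = true → σ.root v
  cond : c.Holds α

/-- The labelling `σ'` results from `σ` by applying a node rule at `v`. -/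
structure NodeUpd (σ : Labelling S) (p q : RuleNode) (v : S.V) (α : Assignment)
    (σ' : Labelling S) : Prop where
  list : σ'.list v = q.list.eval α
  list_of_ne : ∀ u, u ≠ v → σ'.list u = σ.list u
  mark : σ'.mark v = q.mark.inst (σ.mark v)
  mark_of_ne : ∀ u, u ≠ v → σ'.mark u = σ.mark u
  root : σ'.root v ↔ q.root = true ∨ σ.root v ∧ p.root = false
  root_of_ne : ∀ u, u ≠ v → (σ'.root u ↔ σ.root u)
  emark : ∀ f, σ'.emark f = σ.emark f

theorem good_nodeRule {p q : RuleNode} {c : Cond} (hR : Rep S σ H)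
    (happ : ∀ v α, NodeOcc σ p c v α → ∀ H', (∀ σ', NodeUpd σ p q v α σ' → Rep S σ' H') → Q H')
    (hfail : (∀ v α, ¬ NodeOcc σ p c v α) → F) :
    Good Q F (.run (rule (nodeRule p q c)) H) := by
  refine Good.call ?_ ?_
  · simp only [List.mem_singleton, forall_eq]
    intro g
    obtain ⟨n, ed, α, h, h'⟩ := Match.exists_appliesAt (k := 1) (d := 0) (m := 0)
      (p := Sum.elim ![p] ![]) (q := Sum.elim ![q] ![]) (e := ![]) (e' := ![]) hR
      (fun i => i.elim0) (fun i => i.elim0) (fun i => i.elim0) g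
    refine happ (n (.inl 0)) α ⟨h.list (.inl 0), h.mark (.inl 0), h.root (.inl 0), h.cond⟩ _
      fun σ' hu => h' σ' ?_
    refine ⟨?_, fun v hv => hu.list_of_ne v (hv _), ?_, fun j => j.elim0,
      fun v hv => hu.mark_of_ne v (hv _), ?_, fun j => j.elim0, fun v hv => hu.root_of_ne v (hv _),
      fun i => i.elim0, fun f _ => hu.emark f⟩
    · rintro (j | j)
      · obtain rfl := Subsingleton.elim j 0; exact hu.list
      · exact j.elim0
    · intro j; obtain rfl := Subsingleton.elim j 0; exact hu.mark
    · intro j; obtain rfl := Subsingleton.elim j 0; exact hu.root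
  · intro hr
    refine hfail fun v α h => ?_
    refine not_isEmpty_iff.2 ?_ (hr (nodeRule p q c) (List.mem_singleton_self _))
    refine AppliesAt.exists_match (k := 1) (d := 0) (m := 0)
      (p := Sum.elim ![p] ![]) (q := Sum.elim ![q] ![]) (e := ![]) (e' := ![])
      (n := fun _ => v) (ed := Fin.elim0) (α := α) hR ?_
    have hs : ∀ j : Fin 1 ⊕ Fin 0, j = .inl 0 := by
      rintro (j | j)
      · obtain rfl := Subsingleton.elim j 0; rfl
      · exact j.elim0
    refine ⟨fun a b _ => (hs a).trans (hs b).symm, fun a => a.elim0, fun i => i.elim0,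
      fun i => i.elim0, fun j => ?_, fun j => ?_, fun i => i.elim0, fun i => i.elim0,
      fun j => ?_, fun j => j.elim0, h.cond⟩
    all_goals rw [hs j]
    exacts [h.list, h.mark, h.root]

/-- The occurrences of an edge rule. -/
structure EdgeOcc (σ : Labelling S) (p q l : ListExpr) (m : Mark) (c : Cond) (f : S.E)
    (α : Assignment) : Prop where
  ne : S.src f ≠ S.tgt f
  src_list : σ.list (S.src f) = p.eval α
  tgt_list : σ.list (S.tgt f) = q.eval α
  src_mark : σ.mark (S.src f) = .blue
  tgt_mark : σ.mark (S.tgt f) ≠ .unmarked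
  src_root : σ.root (S.src f)
  elist : S.elist f = l.eval α
  emark : σ.emark f = m
  cond : c.Holds α

/-- The labelling `σ'` results from `σ` by applying an edge rule at `f`. -/
structure EdgeUpd (σ : Labelling S) (q' : ListExpr) (m' : Mark) (f : S.E)
    (α : Assignment) (σ' : Labelling S) : Prop where
  list : σ'.list (S.tgt f) = q'.eval α
  list_of_ne : ∀ v, v ≠ S.tgt f → σ'.list v = σ.list v
  mark : ∀ v, σ'.mark v = σ.mark v
  root : ∀ v, σ'.root v ↔ σ.root v
  emark : σ'.emark f = m'
  emark_of_ne : ∀ f', f' ≠ f → σ'.emark f' = σ.emark f'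

variable {p q q' l : ListExpr} {m m' : Mark} {c : Cond}

theorem forall_fin_two_sum {P : Fin 2 ⊕ Fin 0 → Prop} (h0 : P (.inl 0)) (h1 : P (.inl 1)) :
    ∀ j, P j := by
  rintro (j | j)
  · revert j; exact Fin.forall_fin_two.2 ⟨h0, h1⟩
  · exact j.elim0

/-- The matched edge determines both nodes of the occurrence, so an occurrence is just an edge with
an assignment; injectivity of the match becomes the absence of a loop. -/
theorem exists_edgeOcc (hR : Rep S σ H) (g : Match (edgeRule p q q' l m m' c) H) :
    ∃ f α, EdgeOcc σ p q l m c f α ∧ ∀ σ', EdgeUpd σ q' m' f α σ' → Rep S σ' g.result := by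
  obtain ⟨n, ed, α, h, h'⟩ := Match.exists_appliesAt (k := 2) (d := 0) (m := 1)
    (p := Sum.elim ![rooted p .blue, anyNode q] ![])
    (q := Sum.elim ![rooted p .blue, anyNode q'] ![])
    (e := ![⟨.inl 0, .inl 1, l, m⟩]) (e' := ![⟨.inl 0, .inl 1, l, m'⟩]) hR
    (fun i => by fin_cases i; rfl) (fun i => by fin_cases i; rfl) (fun i => by fin_cases i; rfl) g
  have hs : S.src (ed 0) = n (.inl 0) := h.src 0
  have ht : S.tgt (ed 0) = n (.inl 1) := h.tgt 0
  have hne : n (.inl 0) ≠ n (.inl 1) := fun hh => by simpa using h.node_inj hh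
  refine ⟨ed 0, α, ⟨?_, ?_, ?_, ?_, ?_, ?_, h.elist 0, h.emark 0, h.cond⟩, fun σ' hu => h' σ' ?_⟩
  · rwa [hs, ht]
  · rw [hs]; exact h.list _
  · rw [ht]; exact h.list _
  · rw [hs]; exact h.mark (.inl 0)
  · rw [ht]; exact h.mark (.inl 1)
  · rw [hs]; exact h.root _ rfl
  · refine ⟨forall_fin_two_sum ?_ ?_, fun v hv => hu.list_of_ne v (ht ▸ hv _),
      Fin.forall_fin_two.2 ⟨?_, ?_⟩, fun j => j.elim0,
      fun v hv => hu.mark v, Fin.forall_fin_two.2 ⟨?_, ?_⟩, fun j => j.elim0,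
      fun v hv => hu.root v, ?_, fun f hf => hu.emark_of_ne f (hf 0)⟩
    · rw [hu.list_of_ne _ (ht ▸ hne)]; exact h.list _
    · rw [← ht]; exact hu.list
    · exact (hu.mark _).trans (h.mark (.inl 0))
    · exact hu.mark _
    · exact (hu.root _).trans (iff_of_true (h.root _ rfl) (.inl rfl))
    · rw [hu.root]
      simp [anyNode]
    · intro j; obtain rfl := Subsingleton.elim j 0; exact hu.emark

theorem EdgeOcc.exists_match (hR : Rep S σ H) {f α} (h : EdgeOcc σ p q l m c f α) :
    Nonempty (Match (edgeRule p q q' l m m' c) H) := by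
  refine AppliesAt.exists_match (k := 2) (d := 0) (m := 1)
    (p := Sum.elim ![rooted p .blue, anyNode q] ![])
    (q := Sum.elim ![rooted p .blue, anyNode q'] ![])
    (e := ![⟨.inl 0, .inl 1, l, m⟩]) (e' := ![⟨.inl 0, .inl 1, l, m'⟩])
    (n := Sum.elim ![S.src f, S.tgt f] Fin.elim0) (ed := fun _ => f) (α := α) hR ?_
  refine ⟨?_, fun a b _ => Subsingleton.elim a b, fun i => ?_, fun i => ?_,
    forall_fin_two_sum h.src_list h.tgt_list, forall_fin_two_sum h.src_mark h.tgt_mark,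
    fun i => ?_, fun i => ?_, forall_fin_two_sum (fun _ => h.src_root) nofun,
    fun j => j.elim0, h.cond⟩
  · refine forall_fin_two_sum (forall_fin_two_sum (fun _ => rfl) fun hh => absurd hh h.ne)
      (forall_fin_two_sum (fun hh => absurd hh.symm h.ne) fun _ => rfl)
  all_goals obtain rfl := Subsingleton.elim i 0
  exacts [rfl, rfl, h.elist, h.emark]

theorem good_edgeRule (hR : Rep S σ H)
    (happ : ∀ f α, EdgeOcc σ p q l m c f α → ∀ H',
      (∀ σ', EdgeUpd σ q' m' f α σ' → Rep S σ' H') → Q H')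
    (hfail : (∀ f α, ¬ EdgeOcc σ p q l m c f α) → F) :
    Good Q F (.run (rule (edgeRule p q q' l m m' c)) H) := by
  refine Good.call ?_ ?_
  · simp only [List.mem_singleton, forall_eq]
    intro g
    obtain ⟨f, α, h, h'⟩ := exists_edgeOcc hR g
    exact happ f α h _ h'
  · intro hr
    exact hfail fun f α h => not_isEmpty_iff.2 (h.exists_match hR)
      (hr _ (List.mem_singleton_self _))

theorem good_count (hR : Rep S σ H)
    (happ : ∀ u v i, u ≠ v → σ.mark u = .grey → σ.list v = [.int i] →
      σ.mark v = .green → ∀ H', (∀ σ' : Labelling S, σ'.list u = σ.list u ++ [.str strF] →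
        σ'.mark u = .blue → σ'.list v = [.int (i + 1)] → σ'.mark v = .green →
        (∀ w, w ≠ u → w ≠ v → σ'.list w = σ.list w ∧ σ'.mark w = σ.mark w) →
        (∀ w, σ'.root w ↔ σ.root w) → (∀ f, σ'.emark f = σ.emark f) → Rep S σ' H') → Q H')
    (hfail : (∀ u v i, u ≠ v → σ.mark u = .grey → σ.list v = [.int i] → σ.mark v ≠ .green) → F) :
    Good Q F (.run (rule count) H) := by
  refine Good.call ?_ ?_
  · simp only [List.mem_singleton, forall_eq]
    intro g
    obtain ⟨n, ed, α, h, h'⟩ := Match.exists_appliesAt (k := 2) (d := 0) (m := 0)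
      (p := Sum.elim ![plain x .grey, plain (.int i) .green] ![])
      (q := Sum.elim ![plain (snocF x) .blue, plain (.int (.add i (.const 1))) .green] ![])
      (e := ![]) (e' := ![]) hR
      (fun i => i.elim0) (fun i => i.elim0) (fun i => i.elim0) g
    have hne : n (.inl 0) ≠ n (.inl 1) := fun hh => by simpa using h.node_inj hh
    refine happ (n (.inl 0)) (n (.inl 1)) (α.I .i) hne (h.mark (.inl 0)) (h.list (.inl 1))
      (h.mark (.inl 1)) _ fun σ' h1 h2 h3 h4 h5 h6 h7 => h' σ' ?_
    refine ⟨forall_fin_two_sum (h1.trans (by rw [h.list]; rfl)) h3,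
      fun v hv => (h5 v (hv _) (hv _)).1,
      Fin.forall_fin_two.2 ⟨h2, h4⟩, fun j => j.elim0, fun v hv => (h5 v (hv _) (hv _)).2,
      Fin.forall_fin_two.2 ⟨?_, ?_⟩, fun j => j.elim0, fun v hv => h6 v,
      fun i => i.elim0, fun f _ => h7 f⟩
    all_goals simp [plain, h6]
  · intro hr
    refine hfail fun u v i hne hu hv hv' => ?_
    refine not_isEmpty_iff.2 ?_ (hr count (List.mem_singleton_self _))
    refine AppliesAt.exists_match (k := 2) (d := 0) (m := 0)
      (p := Sum.elim ![plain x .grey, plain (.int BellmanFord.i) .green] ![])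
      (q := Sum.elim ![plain (snocF x) .blue,
        plain (.int (.add BellmanFord.i (.const 1))) .green] ![])
      (e := ![]) (e' := ![]) (n := Sum.elim ![u, v] Fin.elim0) (ed := Fin.elim0)
      (α := ⟨fun _ => σ.list u, fun _ => i⟩) hR ?_
    refine ⟨forall_fin_two_sum (forall_fin_two_sum (fun _ => rfl) fun hh => absurd hh hne)
        (forall_fin_two_sum (fun hh => absurd hh.symm hne) fun _ => rfl),
      fun a => a.elim0, fun i => i.elim0, fun i => i.elim0,
      forall_fin_two_sum rfl hv, forall_fin_two_sum hu hv', fun i => i.elim0, fun i => i.elim0,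
      forall_fin_two_sum nofun nofun, fun j => j.elim0, trivial⟩

/-- The left-hand side has no edges, so the dangling condition for the deleted node says exactly
that it is isolated. -/
theorem good_no_deg (hR : Rep S σ H)
    (happ : ∀ v, σ.mark v = .blue → σ.root v → (∀ f, S.src f ≠ v ∧ S.tgt f ≠ v) → ∀ H',
      (∀ σ' : Labelling S, (∀ u, σ'.list u = σ.list u) → σ'.mark v = .unmarked → ¬ σ'.root v →
        (∀ u, u ≠ v → σ'.mark u = σ.mark u ∧ (σ'.root u ↔ σ.root u)) →
        (∀ f, σ'.emark f = σ.emark f) → Rep S σ' H') → Q H')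
    (hfail : (∀ v, σ.mark v = .blue → σ.root v → ∃ f, S.src f = v ∨ S.tgt f = v) → F) :
    Good Q F (.run (rule no_deg) H) := by
  have hs : ∀ j : Fin 0 ⊕ Fin 1, j = .inr 0 := by
    rintro (j | j)
    · exact j.elim0
    · obtain rfl := Subsingleton.elim j 0; rfl
  refine Good.call ?_ ?_
  · simp only [List.mem_singleton, forall_eq]
    intro g
    obtain ⟨n, ed, α, h, h'⟩ := Match.exists_appliesAt (k := 0) (d := 1) (m := 0)
      (p := Sum.elim ![] ![rooted x .blue]) (q := Sum.elim ![] ![plain x .unmarked])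
      (e := ![]) (e' := ![]) hR
      (fun i => i.elim0) (fun i => i.elim0) (fun i => i.elim0) g
    refine happ (n (.inr 0)) (h.mark (.inr 0)) (h.root (.inr 0) rfl)
      (fun f => h.dangling 0 f fun ⟨i, _⟩ => i.elim0) _ fun σ' h1 h2 h3 h4 h5 => h' σ' ?_
    refine ⟨fun j => ?_, fun v hv => h1 v, fun j => j.elim0, fun j => ?_,
      fun v hv => (h4 v (hv _)).1, fun j => j.elim0, fun j => ?_,
      fun v hv => (h4 v (hv _)).2, fun i => i.elim0, fun f _ => h5 f⟩
    · rw [hs j, h1]; exact h.list _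
    · obtain rfl := Subsingleton.elim j 0; exact h2
    · obtain rfl := Subsingleton.elim j 0; exact iff_of_false h3 nofun
  · intro hr
    refine hfail fun v hv hv' => ?_
    by_contra! hf
    refine not_isEmpty_iff.2 ?_ (hr no_deg (List.mem_singleton_self _))
    refine AppliesAt.exists_match (k := 0) (d := 1) (m := 0)
      (p := Sum.elim ![] ![rooted x .blue]) (q := Sum.elim ![] ![plain x .unmarked])
      (e := ![]) (e' := ![])
      (n := fun _ => v) (ed := Fin.elim0) (α := ⟨fun _ => σ.list v, fun _ => 0⟩) hR ?_
    refine ⟨fun a b _ => (hs a).trans (hs b).symm, fun a => a.elim0, fun i => i.elim0,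
      fun i => i.elim0, fun j => ?_, fun j => ?_, fun i => i.elim0, fun i => i.elim0,
      fun j _ => hv', fun j f _ => hf f, trivial⟩
    all_goals rw [hs j]
    exacts [rfl, hv]

end rules

open Classical

/-! ## States of the program -/

/-- The shape of the graphs during the execution: the input graph `G` with a counter node `none` and
a counter edge `none` to `r`. -/
abbrev counterShape (G : HostGraph) (r : G.V) : Shape where
  V := Option G.V
  E := Option G.E
  src := Option.map G.src
  tgt e := some (e.elim r G.tgt)
  elist e := e.elim [] G.elist

/-- The shape of the input graph. -/
abbrev inputShape (G : HostGraph) : Shape := ⟨G.V, G.E, G.src, G.tgt, G.elist⟩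

/-- The labelling in which the list `t v` is appended to the list of each node `v`. -/
def counterLab {G : HostGraph} (r : G.V) (t : G.V → List Atom) (nm : G.V → Mark) (rt : Option G.V)
    (em : G.E → Mark) (c : ℤ) : Labelling (counterShape G r) where
  list := fun v : Option G.V => v.elim [.int c] fun v => G.list v ++ t v
  mark := fun v : Option G.V => v.elim .green nm
  root := fun v : Option G.V => v.elim False fun v => rt = some v
  emark := fun e : Option G.E => e.elim .dashed em

/-- The labelling of the input shape in which `t v` is appended to the list of each node `v`. -/
def outputLab {G : HostGraph} (t : G.V → List Atom) (nm : G.V → Mark) (em : G.E → Mark) :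
    Labelling (inputShape G) where
  list := fun v => G.list v ++ t v
  mark := nm
  root := G.root
  emark := em

/-- A reducible copy of the rule `set_counter`. -/
abbrev setCounter : Rule where
  k := 1
  d := 0
  a := 1
  lhs := ⟨Sum.elim ![rooted x .grey] ![], 0, ![]⟩
  rhs := ⟨Sum.elim ![plain (snocInt x (.const 0)) .blue] ![plain (.int (.const 0)) .green],
    1, ![⟨.inr 0, .inl 0, .empty, .dashed⟩]⟩
  cond := .always

/-- A reducible copy of the rule `delete_counter`. -/
abbrev deleteCounter : Rule where
  k := 1
  d := 1
  a := 0
  lhs := ⟨Sum.elim ![plain x .grey] ![plain y .green], 1, ![⟨.inr 0, .inl 0, .empty, .dashed⟩]⟩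
  rhs := ⟨Sum.elim ![rooted x .grey] ![], 0, ![]⟩
  cond := .always

/-- This rule changes the number of nodes, so the isomorphism is built by hand, with `none` standing
for the added node and edge. The match at `r` always exists, which excludes failure. -/
theorem good_set_counter {G : HostGraph} {r : G.V} (hG : IsInput G) (hr : G.root r)
    {Q : HostGraph → Prop} {F : Prop}
    (happ : ∀ H', Rep _ (counterLab r (Function.update (fun _ => []) r [.int 0])
      (Function.update (fun _ => .grey) r .blue) none (fun _ => .unmarked) 0) H' → Q H') :
    Good Q F (.run (rule set_counter) G) := by
  have huniq : ∀ v, G.root v → v = r := fun v hv => hG.root.unique hv hr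
  change Good Q F (.run (.call [setCounter]) G)
  refine Good.call ?_ ?_
  · simp only [List.mem_singleton, forall_eq]
    intro g
    have hn : g.node (.inl 0) = r := huniq _ (g.root_eq (.inl 0) rfl)
    have hx : G.list r = g.asg.L .x := hn ▸ g.list_eq (.inl 0)
    have hne : ∀ v, v ≠ r → ∀ k, g.node (.inl k) ≠ v := by
      rintro v hv k rfl
      obtain rfl := Subsingleton.elim k (0 : Fin 1)
      exact hv hn
    let φ : Option G.V ≃ g.ResV :=
      { toFun := fun v => v.elim (.inr (0 : Fin 1)) fun v => .inl ⟨v, fun d => d.elim0⟩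
        invFun := Sum.elim (fun v => some v.1) fun _ => none
        left_inv := by rintro (_ | v) <;> rfl
        right_inv := by
          rintro (v | j)
          · rfl
          · exact congrArg Sum.inr (Subsingleton.elim (0 : Fin 1) j) }
    let ψ : Option G.E ≃ g.ResE :=
      { toFun := fun v => v.elim (.inr (0 : Fin 1)) fun v => .inl ⟨v, fun ⟨i, _⟩ => i.elim0⟩
        invFun := Sum.elim (fun v => some v.1) fun _ => none
        left_inv := by rintro (_ | v) <;> rfl
        right_inv := by
          rintro (v | j)
          · rfl
          · exact congrArg Sum.inr (Subsingleton.elim (0 : Fin 1) j) }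
    refine happ _ ⟨φ, ψ, ?_, ?_, ?_, ?_, ?_, ?_, ?_⟩
    · rintro (_ | e) <;> rfl
    · rintro (_ | e)
      · exact congrArg Sum.inl (Subtype.ext hn)
      · rfl
    · rintro (_ | e) <;> rfl
    · rintro (_ | v)
      · rfl
      · by_cases hv : v = r
        · subst hv
          have := g.resList_inl 0 fun d => d.elim0
          simp only [hn] at this
          refine this.trans ?_
          simp only [counterLab, Option.elim, Function.update_self, hx]
          rfl
        · refine (g.resList_of_ne _ (hne v hv)).trans ?_
          simp [counterLab, hv]
    · rintro (_ | v)
      · rfl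
      · by_cases hv : v = r
        · subst hv
          have := g.resMark_inl 0 fun d => d.elim0
          simp only [hn] at this
          refine this.trans ?_
          simp only [counterLab, Option.elim, Function.update_self]
          rfl
        · refine (g.resMark_of_ne _ (hne v hv)).trans ?_
          simp [counterLab, hv, hG.grey]
    · rintro (_ | v)
      · exact iff_of_false nofun id
      · refine iff_of_false ?_ nofun
        by_cases hv : v = r
        · subst hv
          have := g.resRoot_inl 0 fun d => d.elim0
          simp only [hn] at this
          refine mt this.1 ?_
          simp [plain, rooted]
        · exact mt (g.resRoot_of_ne _ (hne v hv)).1 fun h => hv (huniq v h)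
    · rintro (_ | e)
      · rfl
      · exact (hG.edges e).1
  · intro h
    refine ((h setCounter (List.mem_singleton_self _)).false ?_).elim
    have hs : ∀ j : Fin 1 ⊕ Fin 0, j = .inl 0 := by
      rintro (j | j)
      · obtain rfl := Subsingleton.elim j 0; rfl
      · exact j.elim0
    refine ⟨fun _ => r, fun i => i.elim0, ⟨fun _ => G.list r, fun _ => 0⟩,
      fun a b _ => (hs a).trans (hs b).symm, fun i => i.elim0, fun i => i.elim0,
      fun i => i.elim0, fun j => ?_, fun j => ?_, fun i => i.elim0, fun i => i.elim0, fun _ _ => hr,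
      fun d => d.elim0, trivial⟩
    all_goals rw [hs j]
    exacts [rfl, hG.grey r]

/-- The marks green and dashed pin down the counter node and the counter edge, and the target of
that edge is `r`; the match is therefore forced. -/
theorem good_delete_counter {G : HostGraph} {r : G.V} (hG : IsInput G) (hr : G.root r)
    {Q : HostGraph → Prop} {F : Prop} {t : G.V → List Atom} {nm : G.V → Mark} {em : G.E → Mark}
    {c : ℤ} {H : HostGraph} (hR : Rep _ (counterLab r t nm none em c) H)
    (hgrey : nm r = .grey) (hnm : ∀ v, nm v ≠ .green) (hem : ∀ e, em e ≠ .dashed)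
    (happ : ∀ H', Rep _ (outputLab t nm em) H' → Q H') :
    Good Q F (.run (rule delete_counter) H) := by
  obtain ⟨φ, ψ, hR⟩ := hR
  change Good Q F (.run (.call [deleteCounter]) H)
  refine Good.call ?_ ?_
  · simp only [List.mem_singleton, forall_eq]
    intro g
    have hn : g.node (.inr 0) = φ (none : Option G.V) := by
      have h1 : H.mark (g.node (.inr 0)) = .green := g.mark_eq (.inr 0)
      obtain ⟨v, hv⟩ := φ.surjective (g.node (.inr 0))
      rw [← hv, hR.mark] at h1
      rcases v with _ | v
      · exact hv.symm
      · exact absurd h1 (hnm v)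
    have he : g.edge 0 = ψ (none : Option G.E) := by
      have h1 : H.emark (g.edge 0) = .dashed := g.emark_eq 0
      obtain ⟨e, he⟩ := ψ.surjective (g.edge 0)
      rw [← he, hR.emark] at h1
      rcases e with _ | e
      · exact he.symm
      · exact absurd h1 (hem e)
    have hk : g.node (.inl 0) = φ (some r : Option G.V) := by
      have : H.tgt (g.edge 0) = g.node (.inl 0) := g.tgt_eq 0
      rw [← this, he, hR.tgt]; rfl
    have hx : G.list r ++ t r = g.asg.L .x :=
      (hR.list (some r : Option G.V)).symm.trans (hk ▸ g.list_eq (.inl 0))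
    have hVn : ∀ (v : G.V) (d : Fin 1), φ (some v : Option G.V) ≠ g.node (.inr d) := by
      intro v d h
      obtain rfl := Subsingleton.elim d (0 : Fin 1)
      rw [hn] at h
      exact Option.some_ne_none v (φ.injective h)
    have hEn : ∀ e : G.E, ψ (some e : Option G.E) ∉ Set.range g.edge := by
      rintro e ⟨i, hi⟩
      obtain rfl := Subsingleton.elim i (0 : Fin 1)
      rw [he] at hi
      exact Option.some_ne_none e (ψ.injective hi.symm)
    have hne : ∀ v, v ≠ r → ∀ k, g.node (.inl k) ≠ φ (some v : Option G.V) := by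
      intro v hv k hk'
      obtain rfl := Subsingleton.elim k (0 : Fin 1)
      rw [hk] at hk'
      exact hv (Option.some_injective _ (φ.injective hk')).symm
    let fV : G.V → g.ResV := fun v => .inl ⟨φ (some v : Option G.V), hVn v⟩
    let fE : G.E → g.ResE := fun e => .inl ⟨ψ (some e : Option G.E), hEn e⟩
    have hV : Function.Bijective fV := by
      constructor
      · intro v v' h
        exact Option.some_injective _ (φ.injective (Subtype.ext_iff.1 (Sum.inl_injective h)))
      · rintro (⟨v, hv⟩ | j)
        · obtain ⟨v, rfl⟩ := φ.surjective v
          rcases v with _ | v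
          · exact absurd hn.symm (hv 0)
          · exact ⟨v, rfl⟩
        · exact j.elim0
    have hE : Function.Bijective fE := by
      constructor
      · intro v v' h
        exact Option.some_injective _ (ψ.injective (Subtype.ext_iff.1 (Sum.inl_injective h)))
      · rintro (⟨v, hv⟩ | j)
        · obtain ⟨v, rfl⟩ := ψ.surjective v
          rcases v with _ | v
          · exact absurd ⟨0, he⟩ hv
          · exact ⟨v, rfl⟩
        · exact j.elim0
    refine happ _ ⟨Equiv.ofBijective fV hV, Equiv.ofBijective fE hE, ?_, ?_, ?_, ?_, ?_, ?_, ?_⟩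
    · exact fun e => congrArg Sum.inl (Subtype.ext (hR.src (some e : Option G.E)))
    · exact fun e => congrArg Sum.inl (Subtype.ext (hR.tgt (some e : Option G.E)))
    · exact fun e => hR.elist (some e : Option G.E)
    · intro v
      by_cases hv : v = r
      · subst hv
        have := g.resList_inl 0 fun d => hk ▸ hVn v d
        simp only [hk] at this
        exact this.trans hx.symm
      · exact (g.resList_of_ne _ (hne v hv)).trans (hR.list (some v : Option G.V))
    · intro v
      by_cases hv : v = r
      · subst hv
        have := g.resMark_inl 0 fun d => hk ▸ hVn v d
        simp only [hk] at this
        exact this.trans hgrey.symm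
      · exact (g.resMark_of_ne _ (hne v hv)).trans (hR.mark (some v : Option G.V))
    · intro v
      by_cases hv : v = r
      · subst hv
        have := g.resRoot_inl 0 fun d => hk ▸ hVn v d
        simp only [hk] at this
        exact iff_of_true (this.2 (.inl rfl)) hr
      · refine iff_of_false (fun h => ?_) fun h => hv (hG.root.unique h hr)
        have := (hR.root (some v : Option G.V)).1 ((g.resRoot_of_ne _ (hne v hv)).1 h)
        cases this
    · exact fun e => hR.emark (some e : Option G.E)
  · intro h
    refine ((h deleteCounter (List.mem_singleton_self _)).false ?_).elim
    have hVn : ∀ v : G.V, φ (some v : Option G.V) ≠ φ (none : Option G.V) := fun v hv =>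
      Option.some_ne_none v (φ.injective hv)
    have key : ∀ {P : Fin 1 ⊕ Fin 1 → Prop}, P (.inl 0) → P (.inr 0) → ∀ j, P j := by
      rintro P h0 h1 (j | j) <;> obtain rfl := Subsingleton.elim j (0 : Fin 1)
      exacts [h0, h1]
    refine ⟨Sum.elim (fun _ => φ (some r : Option G.V)) fun _ => φ (none : Option G.V),
      fun _ => ψ (none : Option G.E), ⟨fun v => if v = .x then G.list r ++ t r else [.int c],
      fun _ => 0⟩, ?_, fun a b _ => Subsingleton.elim (α := Fin 1) a b, fun i => ?_,
      fun i => ?_, ?_, ?_, fun i => ?_, fun i => ?_, ?_, ?_, trivial⟩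
    · exact key (key (fun _ => rfl) fun h => absurd h (hVn r))
        (key (fun h => absurd h.symm (hVn r)) fun _ => rfl)
    · obtain rfl := Subsingleton.elim i (0 : Fin 1); exact hR.src _
    · obtain rfl := Subsingleton.elim i (0 : Fin 1); exact hR.tgt _
    · exact key (hR.list (some r : Option G.V)) (hR.list (none : Option G.V))
    · exact key ((hR.mark (some r : Option G.V)).trans hgrey) (hR.mark (none : Option G.V))
    · obtain rfl := Subsingleton.elim i (0 : Fin 1); exact hR.elist _
    · obtain rfl := Subsingleton.elim i (0 : Fin 1); exact hR.emark _
    · exact key nofun nofun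
    · intro d f hf
      obtain ⟨f, rfl⟩ := ψ.surjective f
      rcases f with _ | f
      · exact absurd ⟨(0 : Fin 1), rfl⟩ hf
      -- Every edge except the counter edge joins two nodes of `G`, so deleting the counter node
      -- leaves no dangling edge.
      · rw [hR.src, hR.tgt]
        exact ⟨hVn _, hVn _⟩

/-- The atom representing a distance. -/
def distAtom : WithTop ℤ → Atom
  | none => .str strF
  | some d => .int d

theorem distAtom_top : distAtom ⊤ = .str strF := rfl

theorem distAtom_coe (d : ℤ) : distAtom d = .int d := rfl

theorem distAtom_eq_int {a : WithTop ℤ} {i : ℤ} : distAtom a = .int i ↔ a = i := by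
  induction a with
  | top => simp [distAtom_top]
  | coe a => simp [distAtom_coe]

theorem distAtom_eq_str {a : WithTop ℤ} : distAtom a = .str strF ↔ a = ⊤ := by
  induction a with
  | top => simp [distAtom_top]
  | coe a => simp [distAtom_coe]

/-- The abstract states of the main part of the program: the tentative distances, the node marks,
the root, the edge marks, and the value of the counter. -/
structure St (G : HostGraph) where
  d : G.V → WithTop ℤ
  nm : G.V → Mark
  rt : Option G.V
  em : G.E → Mark
  c : ℤ

variable {G : HostGraph} {r : G.V}

/-- The labelling described by an abstract state. -/
abbrev St.lab (r : G.V) (s : St G) : Labelling (counterShape G r) :=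
  counterLab r (fun v => [distAtom (s.d v)]) s.nm s.rt s.em s.c

/-- The host graph `H` is in the abstract state `s`. -/
def Enc (r : G.V) (s : St G) (H : HostGraph) : Prop := Rep _ (s.lab r) H

/-- The relaxation of an edge. -/
noncomputable def relax (d : G.V → WithTop ℤ) (e : G.E) : G.V → WithTop ℤ :=
  Function.update d (G.tgt e) (min (d (G.tgt e)) (d (G.src e) + (G.weight e : WithTop ℤ)))

/-- The edge `e` can be relaxed, and its target has been visited. -/
def Reducible (d : G.V → WithTop ℤ) (e : G.E) : Prop :=
  d (G.tgt e) ≠ ⊤ ∧ d (G.src e) + (G.weight e : WithTop ℤ) < d (G.tgt e)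

/-! ### The effect of each rule call on abstract states -/

section specs

variable {s : St G} {H : HostGraph} {Q : HostGraph → Prop} {F : Prop}

/-- Covers `root1` and `root2`. The condition on `m` keeps the rule away from the counter node. -/
theorem good_enter (hR : Enc r s H) {m m' : Mark} (hm : m ≠ .green) (hrt : s.rt = none)
    (happ : ∀ v, s.nm v = m → ∀ H',
      Enc r { s with nm := Function.update s.nm v m', rt := some v } H' → Q H')
    (hfail : (∀ v, s.nm v ≠ m) → F) :
    Good Q F (.run (rule (nodeRule (plain x m) (rooted x m') .always)) H) := by
  refine good_nodeRule hR ?_ ?_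
  · rintro (_ | v) α hocc H' hu
    · exact absurd hocc.mark.symm hm
    · have hl := hocc.list
      refine happ v hocc.mark H' (hu _ ⟨hl, fun u _ => ?_, ?_, ?_, ?_, ?_, fun f => rfl⟩)
      · rcases u with _ | u <;> rfl
      · exact Function.update_self v m' s.nm
      · rintro (_ | u) hu
        · rfl
        · exact Function.update_of_ne (fun h => hu (congrArg some h)) _ _
      · exact iff_of_true rfl (.inl rfl)
      · rintro (_ | u) hu
        · rfl
        · refine iff_of_false (fun h => hu h.symm) fun h => ?_
          have h : s.rt = some u := h
          rw [hrt] at h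
          cases h
  · intro h
    exact hfail fun v hv => h (some v) ⟨fun _ => G.list v ++ [distAtom (s.d v)], fun _ => 0⟩
      ⟨rfl, hv, nofun, trivial⟩

/-- Covers `unroot1` and `unroot2`. The only root is `v`, so exactly this occurrence exists and
failure is impossible. -/
theorem good_leave (hR : Enc r s H) {v : G.V} {m' : Mark} (hm : s.nm v = .blue)
    (hrt : s.rt = some v)
    (happ : ∀ H', Enc r { s with nm := Function.update s.nm v m', rt := none } H' → Q H') :
    Good Q F (.run (rule (nodeRule (rooted x .blue) (plain x m') .always)) H) := by
  refine good_nodeRule hR ?_ ?_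
  · rintro (_ | v') α hocc H' hu
    · exact absurd hocc.mark.symm nofun
    · have hl := hocc.list
      have hv : s.rt = some v' := hocc.root rfl
      obtain rfl : v = v' := Option.some_injective _ (hrt.symm.trans hv)
      refine happ H' (hu _ ⟨hl, fun u _ => ?_, ?_, ?_, ?_, ?_, fun f => rfl⟩)
      · rcases u with _ | u <;> rfl
      · exact Function.update_self v m' s.nm
      · rintro (_ | u) hu
        · rfl
        · exact Function.update_of_ne (fun h => hu (congrArg some h)) _ _
      · exact iff_of_false nofun (by simp [plain, rooted])
      · rintro (_ | u) hu
        · rfl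
        · refine iff_of_false nofun fun h => hu ?_
          have h : s.rt = some u := h
          rw [← h, hrt]
  · intro h
    exact (h (some v) ⟨fun _ => G.list v ++ [distAtom (s.d v)], fun _ => 0⟩
      ⟨rfl, hm, fun _ => hrt, trivial⟩).elim

theorem good_decrement (hR : Enc r s H) (hnm : ∀ v, s.nm v ≠ .green)
    (happ : 0 < s.c → ∀ H', Enc r { s with c := s.c - 1 } H' → Q H') (hfail : s.c ≤ 0 → F) :
    Good Q F (.run (rule decrement) H) := by
  refine good_nodeRule hR ?_ ?_
  · rintro (_ | v) α hocc H' hu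
    · have hl : [Atom.int s.c] = [.int (α.I .i)] := hocc.list
      have hc : s.c = α.I .i := by simpa using hl
      have hpos : α.I .i > 0 := hocc.cond
      refine happ (hc ▸ hpos) H' (hu _ ⟨?_, ?_, rfl, ?_, ?_, ?_, fun f => rfl⟩)
      · change [Atom.int (s.c - 1)] = [.int (α.I .i - 1)]
        rw [hc]
      · rintro (_ | u) hu
        · exact absurd rfl hu
        · rfl
      · rintro (_ | u) _ <;> rfl
      · simp only [plain, Bool.false_eq_true, false_or, and_true]
        rfl
      · rintro (_ | u) _ <;> rfl
    · exact absurd hocc.mark (hnm v)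
  · intro h
    refine hfail (not_lt.1 fun hc => ?_)
    exact h none ⟨fun _ => [], fun _ => s.c⟩ ⟨rfl, rfl, nofun, hc⟩

theorem good_set_flag (hR : Enc r s H) (hnm : ∀ v, s.nm v ≠ .green)
    (happ : ∀ H', Enc r { s with c := -1 } H' → Q H') :
    Good Q F (.run (rule set_flag) H) := by
  refine good_nodeRule hR ?_ ?_
  · rintro (_ | v) α hocc H' hu
    · refine happ H' (hu _ ⟨rfl, ?_, rfl, ?_, ?_, ?_, fun f => rfl⟩)
      · rintro (_ | u) hu
        · exact absurd rfl hu
        · rfl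
      · rintro (_ | u) _ <;> rfl
      · simp only [plain, Bool.false_eq_true, false_or, and_true]
        rfl
      · rintro (_ | u) _ <;> rfl
    · exact absurd hocc.mark (hnm v)
  · intro h
    exact (h none ⟨fun _ => [.int s.c], fun _ => 0⟩ ⟨rfl, rfl, nofun, trivial⟩).elim

theorem good_flag (hR : Enc r s H) (hnm : ∀ v, s.nm v ≠ .green)
    (happ : s.c = -1 → ∀ H', Q H') (hfail : s.c ≠ -1 → F) :
    Good Q F (.run (rule flag) H) := by
  refine good_nodeRule hR ?_ ?_
  · rintro (_ | v) α hocc H' hu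
    · have hl : [Atom.int s.c] = [.int (-1)] := hocc.list
      exact happ (by simpa using hl) H'
    · exact absurd hocc.mark (hnm v)
  · intro h
    refine hfail fun hc => h none ⟨fun _ => [], fun _ => 0⟩ ⟨?_, rfl, nofun, trivial⟩
    change [Atom.int s.c] = [.int (-1)]
    rw [hc]

/-- The source is never isolated in the current graph, because the counter edge ends there; hence
the clause `v ≠ r`. -/
theorem good_no_deg_state (hR : Enc r s H) {v : G.V} (hm : s.nm v = .blue) (hrt : s.rt = some v)
    (happ : (v ≠ r ∧ ∀ e, G.src e ≠ v ∧ G.tgt e ≠ v) → ∀ H',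
      Enc r { s with nm := Function.update s.nm v .unmarked, rt := none } H' → Q H')
    (hfail : ¬ (v ≠ r ∧ ∀ e, G.src e ≠ v ∧ G.tgt e ≠ v) → F) :
    Good Q F (.run (rule no_deg) H) := by
  refine good_no_deg hR ?_ ?_
  · rintro (_ | v') hv' hroot hiso H' hu
    · exact hroot.elim
    · obtain rfl : v = v' := Option.some_injective _ (hrt.symm.trans hroot)
      refine happ ⟨?_, fun e => ⟨?_, ?_⟩⟩ H' (hu _ ?_ ?_ nofun ?_ fun f => rfl)
      · rintro rfl; exact (hiso none).2 rfl
      · intro h; exact (hiso (some e)).1 (congrArg some h)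
      · intro h; exact (hiso (some e)).2 (congrArg some h)
      · rintro (_ | u) <;> rfl
      · exact Function.update_self v Mark.unmarked s.nm
      · rintro (_ | u) hu
        · exact ⟨rfl, Iff.rfl⟩
        · refine ⟨Function.update_of_ne (fun h => hu (congrArg some h)) _ _,
            iff_of_false nofun fun h => hu ?_⟩
          have h : s.rt = some u := h
          rw [← h, hrt]
  · intro h
    refine hfail fun ⟨hv, hiso⟩ => ?_
    obtain ⟨f, hf⟩ := h (some v) hm hrt
    rcases f with _ | f
    · rcases hf with hf | hf
      · cases hf
      · exact hv (Option.some_injective _ hf).symm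
    · rcases hf with hf | hf
      · exact (hiso f).1 (Option.some_injective _ hf)
      · exact (hiso f).2 (Option.some_injective _ hf)

/-- Covers `unmarked_edge`, `finish` and `unmark_edge`. The condition `m ≠ .dashed` excludes the
counter edge, and `hnm` guarantees that the mark `any` matches each target. -/
theorem good_edge (hG : IsInput G) (hR : Enc r s H) {u : G.V} (hm : s.nm u = .blue)
    (hrt : s.rt = some u) {m m' : Mark} (hmd : m ≠ .dashed)
    (hnm : ∀ e, s.nm (G.tgt e) ≠ .unmarked)
    (happ : ∀ e, G.src e = u → s.em e = m → ∀ H',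
      Enc r { s with em := Function.update s.em e m' } H' → Q H')
    (hfail : (∀ e, G.src e = u → s.em e ≠ m) → F) :
    Good Q F (.run (rule (edgeRule x y y z m m' .always)) H) := by
  refine good_edgeRule hR ?_ ?_
  · rintro (_ | e) α hocc H' hu
    · exact absurd hocc.emark.symm hmd
    · have hroot : s.rt = some (G.src e) := hocc.src_root
      refine happ e (Option.some_injective _ (hroot.symm.trans hrt)) hocc.emark H'
        (hu _ ⟨hocc.tgt_list, ?_, ?_, ?_, ?_, ?_⟩)
      · rintro (_ | u) _ <;> rfl
      · rintro (_ | u) <;> rfl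
      · rintro (_ | u) <;> rfl
      · exact Function.update_self e m' s.em
      · rintro (_ | u) hu
        · rfl
        · exact Function.update_of_ne (fun h => hu (congrArg some h)) _ _
  · intro h
    refine hfail fun e he hem => ?_
    refine h (some e) ⟨fun v => match v with
      | .x => G.list (G.src e) ++ [distAtom (s.d (G.src e))]
      | .y => G.list (G.tgt e) ++ [distAtom (s.d (G.tgt e))]
      | .z => G.elist e, fun _ => 0⟩
      ⟨fun h => hG.no_loops e (Option.some_injective _ h), rfl, rfl, ?_, hnm e, ?_, rfl, hem,
        trivial⟩
    · subst he; exact hm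
    · subst he; exact hrt

/-- The edge `e` is the only red edge, and its source is a blue root. -/
structure RedEdge (s : St G) (e : G.E) : Prop where
  root : s.rt = some (G.src e)
  src_mark : s.nm (G.src e) = .blue
  tgt_mark : s.nm (G.tgt e) ≠ .unmarked
  red : s.em e = .red
  unique : ∀ f, s.em f = .red → f = e

theorem IsInput.elist_eq (hG : IsInput G) (e : G.E) : G.elist e = [.int (G.weight e)] := by
  obtain ⟨w, hw⟩ := (hG.edges e).2
  simp [HostGraph.weight, hw]

theorem append_atom_inj {a b : List Atom} {u v : Atom} (h : a ++ [u] = b ++ [v]) :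
    a = b ∧ u = v := by
  simpa using List.append_inj' h rfl

/-- Uniqueness of the red edge forces the occurrence, and the last atoms of the node lists reveal
the tentative distances. -/
theorem RedEdge.occ_unvisited (hG : IsInput G) {e : G.E} (he : RedEdge s e) {f α}
    (h : EdgeOcc (s.lab r) (snocInt x BellmanFord.s) (snocF y) (.int w) .red .always f α) :
    f = some e ∧ s.d (G.src e) = (α.I .s : ℤ) ∧ s.d (G.tgt e) = ⊤ ∧ G.weight e = α.I .w ∧
      G.list (G.tgt e) = α.L .y := by
  rcases f with _ | f
  · exact absurd h.emark nofun
  · obtain rfl := he.unique f h.emark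
    have h1 := append_atom_inj h.src_list
    have h2 := append_atom_inj h.tgt_list
    have h3 : [Atom.int (G.weight f)] = [.int (α.I .w)] := (hG.elist_eq f).symm.trans h.elist
    exact ⟨rfl, distAtom_eq_int.1 h1.2, distAtom_eq_str.1 h2.2, by simpa using h3, h2.1⟩

theorem RedEdge.occ_reduce (hG : IsInput G) {e : G.E} (he : RedEdge s e) {f α}
    (h : EdgeOcc (s.lab r) (snocInt x BellmanFord.s) (snocInt y t) (.int w) .red
      (.lt (.add BellmanFord.s w) t) f α) :
    f = some e ∧ s.d (G.src e) = (α.I .s : ℤ) ∧ s.d (G.tgt e) = (α.I .t : ℤ) ∧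
      G.weight e = α.I .w ∧ G.list (G.tgt e) = α.L .y ∧ α.I .s + α.I .w < α.I .t := by
  rcases f with _ | f
  · exact absurd h.emark nofun
  · obtain rfl := he.unique f h.emark
    have h1 := append_atom_inj h.src_list
    have h2 := append_atom_inj h.tgt_list
    have h3 : [Atom.int (G.weight f)] = [.int (α.I .w)] := (hG.elist_eq f).symm.trans h.elist
    exact ⟨rfl, distAtom_eq_int.1 h1.2, distAtom_eq_int.1 h2.2, by simpa using h3, h2.1, h.cond⟩

theorem RedEdge.exists_unvisited (hG : IsInput G) {e : G.E} (he : RedEdge s e)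
    (hs : s.d (G.src e) ≠ ⊤) (ht : s.d (G.tgt e) = ⊤) :
    ∃ α, EdgeOcc (s.lab r) (snocInt x BellmanFord.s) (snocF y) (.int w) .red .always
      (some e) α := by
  obtain ⟨a, ha⟩ := WithTop.ne_top_iff_exists.1 hs
  refine ⟨⟨fun v => if v = .x then G.list (G.src e) else G.list (G.tgt e),
    fun v => if v = .s then a else G.weight e⟩,
    ⟨fun h => hG.no_loops e (Option.some_injective _ h), ?_, ?_, he.src_mark, he.tgt_mark, he.root,
      hG.elist_eq e, he.red, trivial⟩⟩
  · change G.list (G.src e) ++ [distAtom (s.d (G.src e))] = _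
    rw [← ha]; rfl
  · change G.list (G.tgt e) ++ [distAtom (s.d (G.tgt e))] = _
    rw [ht]; rfl

theorem RedEdge.exists_reduce (hG : IsInput G) {e : G.E} (he : RedEdge s e)
    (h : Reducible s.d e) :
    ∃ α, EdgeOcc (s.lab r) (snocInt x BellmanFord.s) (snocInt y t) (.int w) .red
      (.lt (.add BellmanFord.s w) t) (some e) α := by
  obtain ⟨b, hb⟩ := WithTop.ne_top_iff_exists.1 h.1
  have hs : s.d (G.src e) ≠ ⊤ := by
    intro hs
    have := h.2
    simp [hs] at this
  obtain ⟨a, ha⟩ := WithTop.ne_top_iff_exists.1 hs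
  have hlt := h.2
  rw [← ha, ← hb] at hlt
  refine ⟨⟨fun v => if v = .x then G.list (G.src e) else G.list (G.tgt e),
    fun v => if v = .s then a else if v = .t then b else G.weight e⟩,
    ⟨fun h => hG.no_loops e (Option.some_injective _ h), ?_, ?_, he.src_mark, he.tgt_mark, he.root,
      hG.elist_eq e, he.red, by exact_mod_cast hlt⟩⟩
  · change G.list (G.src e) ++ [distAtom (s.d (G.src e))] = _
    rw [← ha]; rfl
  · change G.list (G.tgt e) ++ [distAtom (s.d (G.tgt e))] = _
    rw [← hb]; rfl

/-- Shared by `unvisited` and `reduce`: both replace the last atom of the target by the same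
minimum. -/
theorem enc_relax {e : G.E} (he : RedEdge s e) {α} {y' : List Atom} {c : ℤ}
    (hy : G.list (G.tgt e) = y')
    (hd : min (s.d (G.tgt e)) (s.d (G.src e) + (G.weight e : WithTop ℤ)) = (c : ℤ))
    {q : ListExpr} (hq : q.eval α = y' ++ [.int c])
    (hu : ∀ σ', EdgeUpd (s.lab r) q .red (some e) α σ' → Rep _ σ' H) :
    Enc r { s with d := relax s.d e } H := by
  refine hu _ ⟨?_, ?_, fun v => ?_, fun v => ?_, he.red, fun f _ => rfl⟩
  · change G.list (G.tgt e) ++ [distAtom (relax s.d e (G.tgt e))] = _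
    rw [relax, Function.update_self, hq, hy, hd, distAtom_coe]
  · rintro (_ | v) hv
    · rfl
    · change G.list v ++ [distAtom (relax s.d e v)] = G.list v ++ [distAtom (s.d v)]
      have hne : v ≠ G.tgt e := fun h => hv (congrArg some h)
      rw [relax, Function.update_of_ne hne]
  · rcases v with _ | v <;> rfl
  · rcases v with _ | v <;> rfl

/-- With "f" read as ∞, the two rules and the case where neither applies together compute the single
minimum in `relax`. -/
theorem good_relax (hG : IsInput G) (hR : Enc r s H) {e : G.E} (he : RedEdge s e)
    (happ : ∀ H', Enc r { s with d := relax s.d e } H' → Q H') :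
    Good Q F (.run (.tryte (.call [unvisited, reduce]) .skip .skip) H) := by
  refine Good.tryte (Good.call ?_ ?_)
  · simp only [List.mem_cons, List.not_mem_nil, or_false, forall_eq_or_imp, forall_eq]
    constructor
    · intro g
      refine Good.skip (happ _ ?_)
      obtain ⟨f, α, h, hu⟩ := exists_edgeOcc hR g
      obtain ⟨rfl, h1, h2, h3, h4⟩ := he.occ_unvisited hG h
      refine enc_relax he h4 (c := α.I .s + α.I .w) ?_ rfl hu
      rw [h2, h1, h3, min_eq_right le_top]; rfl
    · intro g
      refine Good.skip (happ _ ?_)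
      obtain ⟨f, α, h, hu⟩ := exists_edgeOcc hR g
      obtain ⟨rfl, h1, h2, h3, h4, h5⟩ := he.occ_reduce hG h
      refine enc_relax he h4 (c := α.I .s + α.I .w) ?_ rfl hu
      rw [h2, h1, h3, min_eq_right]
      · rfl
      · exact_mod_cast h5.le
  · intro h
    refine Good.skip (happ _ ?_)
    -- A strict improvement would yield a match of `unvisited` if the target has value ∞, and of
    -- `reduce` otherwise.
    have hd : relax s.d e = s.d := by
      rw [relax, Function.update_eq_self_iff, min_eq_left]
      by_contra! hlt
      by_cases ht : s.d (G.tgt e) = ⊤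
      · have hs : s.d (G.src e) ≠ ⊤ := by
          intro hs
          simp [hs, ht] at hlt
        obtain ⟨α, hα⟩ := he.exists_unvisited (r := r) hG hs ht
        exact not_isEmpty_iff.2 (hα.exists_match hR) (h unvisited (by simp))
      · obtain ⟨α, hα⟩ := he.exists_reduce (r := r) hG ⟨ht, hlt⟩
        exact not_isEmpty_iff.2 (hα.exists_match hR) (h reduce (by simp))
    rw [hd]
    exact hR

theorem good_if_reduce (hG : IsInput G) (hR : Enc r s H) (hnm : ∀ v, s.nm v ≠ .green) {e : G.E}
    (he : RedEdge s e)
    (happ : ∀ H', Enc r { s with c := if Reducible s.d e then -1 else s.c } H' → Q H') :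
    Good Q F (.run (.ite (rule reduce) (rule set_flag) .skip) H) := by
  refine Good.ite (good_edgeRule hR ?_ ?_)
  · intro f α h H' _
    obtain ⟨rfl, h1, h2, h3, h4, h5⟩ := he.occ_reduce hG h
    refine good_set_flag hR hnm fun H' hH => happ H' ?_
    rw [if_pos]
    · exact hH
    · refine ⟨by simp [h2], ?_⟩
      rw [h2, h1, h3]
      exact_mod_cast h5
  · intro h
    refine Good.skip (happ _ ?_)
    rw [if_neg]
    · exact hR
    · intro hred
      obtain ⟨α, hα⟩ := he.exists_reduce (r := r) hG hred
      exact h _ _ hα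

end specs

/-- Stated for arbitrary appended lists instead of a state `St`, since during counting some nodes
have no distance atom yet. -/
theorem good_count_step {H : HostGraph} {Q : HostGraph → Prop} {F : Prop} {t : G.V → List Atom}
    {nm : G.V → Mark} {em : G.E → Mark} {c : ℤ} (hR : Rep _ (counterLab r t nm none em c) H)
    (hnm : ∀ v, nm v ≠ .green)
    (happ : ∀ v, nm v = .grey → ∀ H', Rep _ (counterLab r
      (Function.update t v (t v ++ [.str strF])) (Function.update nm v .blue) none em (c + 1)) H' →
      Q H')
    (hfail : (∀ v, nm v ≠ .grey) → F) :
    Good Q F (.run (rule count) H) := by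
  refine good_count hR ?_ ?_
  · rintro (_ | u) (_ | v) i hne hu hl hv H' hup
    · exact absurd rfl hne
    · exact absurd hv (hnm v)
    · have hl : [Atom.int c] = [.int i] := hl
      have hc : c = i := by simpa using hl
      refine happ u hu H' (hup _ ?_ ?_ ?_ rfl ?_ ?_ fun f => rfl)
      · change G.list u ++ Function.update t u (t u ++ [.str strF]) u =
          G.list u ++ t u ++ [.str strF]
        rw [Function.update_self, List.append_assoc]
      · exact Function.update_self u Mark.blue nm
      · change [Atom.int (c + 1)] = [.int (i + 1)]
        rw [hc]
      · rintro (_ | w) hw hw'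
        · exact absurd rfl hw'
        · have hwu : w ≠ u := fun h => hw (congrArg some h)
          refine ⟨?_, Function.update_of_ne hwu _ _⟩
          change G.list w ++ Function.update t u (t u ++ [.str strF]) w = G.list w ++ t w
          rw [Function.update_of_ne hwu]
      · rintro (_ | w) <;> rfl
    · exact absurd hv (hnm v)
  · intro h
    exact hfail fun v hv => h (some v) none c nofun hv rfl rfl

theorem good_no_deg_inv {H : HostGraph} {Q : HostGraph → Prop} {F : Prop} {t : G.V → List Atom}
    {nm : G.V → Mark} {em : G.E → Mark} (hR : Rep _ (outputLab t nm em) H)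
    (happ : ∀ v, nm v = .unmarked → ∀ H',
      Rep _ (outputLab t (Function.update nm v .grey) em) H' → Q H')
    (hfail : (∀ v, nm v ≠ .unmarked) → F) :
    Good Q F (.run (rule no_deg_inv) H) := by
  refine good_nodeRule hR ?_ ?_
  · intro (v : G.V) α hocc H' hu
    have hs : Function.update nm v .grey v = .grey := Function.update_self ..
    have hne : ∀ u, u ≠ v → Function.update nm v .grey u = nm u := fun u hu =>
      Function.update_of_ne hu ..
    refine happ v hocc.mark H' (hu _ ⟨hocc.list, fun u _ => rfl, hs, hne, ?_,
      fun u _ => Iff.rfl, fun f => rfl⟩)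
    simp [plain, outputLab]
  · intro h
    exact hfail fun v hv => h v ⟨fun _ => G.list v ++ t v, fun _ => 0⟩ ⟨rfl, hv, nofun, trivial⟩

end BellmanFord

/-! ### Paths, cycles and the shortening of paths -/

namespace HostGraph

variable {G : HostGraph}

theorem isPath_append {a b : List G.E} {u v : G.V} :
    G.IsPath u (a ++ b) v ↔ ∃ x, G.IsPath u a x ∧ G.IsPath x b v := by
  induction a generalizing u with
  | nil => simp [IsPath]
  | cons e a ih => simp [IsPath, ih, and_assoc]

theorem isPath_concat {a : List G.E} {e : G.E} {u : G.V} (h : G.IsPath u a (G.src e)) :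
    G.IsPath u (a ++ [e]) (G.tgt e) :=
  isPath_append.2 ⟨_, h, rfl, rfl⟩

theorem pathWeight_append (a b : List G.E) :
    G.pathWeight (a ++ b) = G.pathWeight a + G.pathWeight b := by
  simp [pathWeight]

theorem pathWeight_cons (e : G.E) (b : List G.E) :
    G.pathWeight (e :: b) = G.weight e + G.pathWeight b := by
  simp [pathWeight]

theorem Reachable.trans {u v w : G.V} (h : G.Reachable u v) (h' : G.Reachable v w) :
    G.Reachable u w := by
  obtain ⟨a, ha⟩ := h
  obtain ⟨b, hb⟩ := h'
  exact ⟨a ++ b, isPath_append.2 ⟨v, ha, hb⟩⟩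

theorem Reachable.edge {u : G.V} {e : G.E} (h : G.Reachable u (G.src e)) :
    G.Reachable u (G.tgt e) :=
  h.trans ⟨[e], rfl, rfl⟩

/-- The nodes visited by the edge sequence `es` of a path ending in `v`. -/
def support (G : HostGraph) (es : List G.E) (v : G.V) : List G.V := es.map G.src ++ [v]

theorem support_append (a b : List G.E) (v : G.V) :
    G.support (a ++ b) v = a.map G.src ++ G.support b v := by
  simp [support]

theorem IsPath.start_mem_support {es : List G.E} {u v : G.V} (h : G.IsPath u es v) :
    u ∈ G.support es v := by
  cases es with
  | nil => cases h; simp [support]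
  | cons e es => simp [support, h.1]

theorem IsPath.split {es : List G.E} {u v x : G.V} (h : G.IsPath u es v)
    (hx : x ∈ G.support es v) : ∃ a b, es = a ++ b ∧ G.IsPath u a x ∧ G.IsPath x b v := by
  induction es generalizing u with
  | nil =>
    obtain rfl : x = v := by simpa [support] using hx
    exact ⟨[], [], rfl, h, rfl⟩
  | cons e es ih =>
    obtain rfl | hx : x = G.src e ∨ x ∈ G.support es v := by simpa [support] using hx
    · exact ⟨[], e :: es, rfl, h.1.symm, rfl, h.2⟩
    · obtain ⟨a, b, rfl, ha, hb⟩ := ih h.2 hx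
      exact ⟨e :: a, b, rfl, ⟨h.1, ha⟩, hb⟩

/-- A path visits no node twice, or it contains a cycle. -/
theorem IsPath.nodup_or_cycle {es : List G.E} {u v : G.V} (h : G.IsPath u es v) :
    (G.support es v).Nodup ∨ ∃ a c b x, es = a ++ (c ++ b) ∧ G.IsPath u a x ∧ G.IsCycle x c ∧
      G.IsPath x b v := by
  induction es generalizing u with
  | nil => simp [support]
  | cons e es ih =>
    rcases ih h.2 with hn | ⟨a, c, b, x, rfl, ha, hc, hb⟩
    · by_cases hu : u ∈ G.support es v
      · obtain ⟨c, b, rfl, hc, hb⟩ := h.2.split hu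
        refine .inr ⟨[], e :: c, b, u, rfl, rfl, ⟨nofun, ⟨h.1, hc⟩, ?_⟩, hb⟩
        -- The sources along `c` are distinct, and `u` is not among them because it occurs in the
        -- support of `b`; so `e :: c` is a cycle.
        rw [support_append, List.nodup_append] at hn
        rw [List.map_cons, List.nodup_cons, h.1]
        exact ⟨fun hu' => hn.2.2 u hu' u hb.start_mem_support rfl, hn.1⟩
      · refine .inl ?_
        change (G.src e :: G.support es v).Nodup
        rw [h.1]
        exact List.nodup_cons.2 ⟨hu, hn⟩
    · exact .inr ⟨e :: a, c, b, x, rfl, ⟨h.1, ha⟩, hc, hb⟩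

/-- Paths can be shortened to fewer edges than there are nodes; the weight does not increase if no
negative cycle is reachable. -/
theorem IsPath.exists_short {es : List G.E} {r v : G.V} (h : G.IsPath r es v) :
    ∃ es', G.IsPath r es' v ∧ es'.length + 1 ≤ Nat.card G.V ∧
      (¬ G.HasNegCycleFrom r → G.pathWeight es' ≤ G.pathWeight es) := by
  induction hn : es.length using Nat.strong_induction_on generalizing es with
  | _ n ih =>
    rcases h.nodup_or_cycle with hd | ⟨a, c, b, x, rfl, ha, hc, hb⟩
    · refine ⟨es, h, ?_, fun _ => le_rfl⟩
      have := G.finV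
      have := Fintype.ofFinite G.V
      -- A path with `n` edges has a support of length `n + 1`.
      have hl := hd.length_le_card
      rw [Nat.card_eq_fintype_card]
      simpa [support] using hl
    · have hlt : (a ++ b).length < n := by
        have := List.length_pos_iff.2 hc.1
        simp only [List.length_append] at hn ⊢
        omega
      obtain ⟨es', h1, h2, h3⟩ := ih _ hlt (isPath_append.2 ⟨x, ha, hb⟩) rfl
      refine ⟨es', h1, h2, fun hneg => (h3 hneg).trans ?_⟩
      have : 0 ≤ G.pathWeight c := not_lt.1 fun hc' => hneg ⟨x, c, ⟨a, ha⟩, hc, hc'⟩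
      simp only [pathWeight_append]
      omega

end HostGraph

/-! ### Invariants of the tentative distances -/

namespace BellmanFord

open Classical HostGraph

variable {G : HostGraph} {r : G.V} {d d' : G.V → WithTop ℤ}

/-- Every finite tentative distance is the weight of a path. -/
def Attained (r : G.V) (d : G.V → WithTop ℤ) : Prop :=
  ∀ v (a : ℤ), d v = a → ∃ es, G.IsPath r es v ∧ G.pathWeight es = a

/-- The tentative distances are at most the weights of all paths with at most `k` edges. -/
def BoundedBy (r : G.V) (k : ℕ) (d : G.V → WithTop ℤ) : Prop :=
  ∀ v es, G.IsPath r es v → es.length ≤ k → d v ≤ (G.pathWeight es : ℤ)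

theorem attained_init : Attained r (Function.update (fun _ => ⊤) r 0) := by
  intro v a h
  by_cases hv : v = r
  · subst hv
    rw [Function.update_self] at h
    exact ⟨[], rfl, by exact_mod_cast h⟩
  · rw [Function.update_of_ne hv] at h
    exact absurd h.symm (WithTop.coe_ne_top)

theorem boundedBy_init : BoundedBy r 0 (Function.update (fun _ => ⊤) r 0) := by
  intro v es h hl
  obtain rfl := List.length_eq_zero_iff.1 (Nat.le_zero.1 hl)
  obtain rfl : r = v := h
  rw [Function.update_self]
  simp [pathWeight]

theorem relax_le (d : G.V → WithTop ℤ) (e : G.E) : relax d e ≤ d := by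
  intro v
  by_cases hv : v = G.tgt e
  · subst hv; rw [relax, Function.update_self]; exact min_le_left _ _
  · rw [relax, Function.update_of_ne hv]

theorem relax_tgt_le (d : G.V → WithTop ℤ) (e : G.E) :
    relax d e (G.tgt e) ≤ d (G.src e) + (G.weight e : WithTop ℤ) := by
  rw [relax, Function.update_self]; exact min_le_right _ _

theorem Attained.relax (h : Attained r d) (e : G.E) : Attained r (relax d e) := by
  intro v a hv
  by_cases hve : v = G.tgt e
  · subst hve
    rw [BellmanFord.relax, Function.update_self] at hv
    rcases min_choice (d (G.tgt e)) (d (G.src e) + (G.weight e : WithTop ℤ)) with hm | hm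
    · exact h _ _ (hm ▸ hv)
    · rw [hm] at hv
      have hs : d (G.src e) ≠ ⊤ := by
        intro hs
        rw [hs, top_add] at hv
        exact WithTop.coe_ne_top hv.symm
      obtain ⟨b, hb⟩ := WithTop.ne_top_iff_exists.1 hs
      obtain ⟨es, hes, hw⟩ := h _ _ hb.symm
      refine ⟨es ++ [e], isPath_concat hes, ?_⟩
      rw [← hb] at hv
      have hv : b + G.weight e = a := by exact_mod_cast hv
      rw [pathWeight_append, hw, ← hv]
      simp [pathWeight]
  · rw [BellmanFord.relax, Function.update_of_ne hve] at hv
    exact h v a hv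

/-- A non-empty path with at most `k + 1` edges is a path with at most `k` edges followed by one
edge. The hypothesis `he` uses the old value at the source, which makes the order of relaxations
irrelevant. -/
theorem BoundedBy.succ {k : ℕ} (h : BoundedBy r k d) (hle : d' ≤ d)
    (he : ∀ e, d' (G.tgt e) ≤ d (G.src e) + (G.weight e : WithTop ℤ)) :
    BoundedBy r (k + 1) d' := by
  intro v es hes hl
  rcases List.eq_nil_or_concat' es with rfl | ⟨es, e, rfl⟩
  · exact (hle v).trans (h v [] hes (Nat.zero_le _))
  · obtain ⟨u, h1, rfl, h2⟩ := isPath_append.1 hes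
    obtain rfl : G.tgt e = v := h2
    have hl : es.length ≤ k := by simpa using hl
    refine (he e).trans ?_
    rw [pathWeight_append]
    have : G.pathWeight [e] = G.weight e := by simp [pathWeight]
    rw [this]
    push_cast
    gcongr
    exact h _ es h1 hl

theorem BoundedBy.le_of_not_hasNegCycle {k : ℕ} (h : BoundedBy r k d)
    (hk : Nat.card G.V ≤ k + 1) (hneg : ¬ G.HasNegCycleFrom r) {v : G.V} {es : List G.E}
    (hes : G.IsPath r es v) : d v ≤ (G.pathWeight es : ℤ) := by
  obtain ⟨es', h1, h2, h3⟩ := hes.exists_short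
  refine (h v es' h1 (by omega)).trans ?_
  exact_mod_cast h3 hneg

/-- Only the length of the shortened path matters here, so negative cycles need not be excluded. -/
theorem BoundedBy.ne_top {k : ℕ} (h : BoundedBy r k d) (hk : Nat.card G.V ≤ k + 1) {v : G.V}
    (hv : G.Reachable r v) : d v ≠ ⊤ := by
  obtain ⟨es, hes⟩ := hv
  obtain ⟨es', h1, h2, -⟩ := hes.exists_short
  exact ne_top_of_le_ne_top WithTop.coe_ne_top (h v es' h1 (by omega))

/-- The edge inequalities telescope along the path. Finiteness is required because `Reducible`
excludes targets of value ∞. -/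
theorem le_add_pathWeight (hd : ∀ v, G.Reachable r v → d v ≠ ⊤) (hred : ∀ e, ¬ Reducible d e)
    {es : List G.E} {u v : G.V} (hu : G.Reachable r u) (h : G.IsPath u es v) :
    d v ≤ d u + (G.pathWeight es : ℤ) := by
  induction es generalizing u with
  | nil => cases h; simp [pathWeight]
  | cons e es ih =>
    obtain ⟨rfl, h⟩ := h
    refine (ih hu.edge h).trans ?_
    have := hred e
    simp only [Reducible, not_and, not_lt] at this
    rw [pathWeight_cons]
    push_cast
    rw [← add_assoc]
    gcongr
    exact this (hd _ hu.edge)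

/-- After sufficiently many rounds, an edge can be relaxed if and only if there is a reachable
negative cycle. -/
theorem exists_reducible_iff {k : ℕ} (ha : Attained r d) (hb : BoundedBy r k d)
    (hk : Nat.card G.V ≤ k + 1) : (∃ e, Reducible d e) ↔ G.HasNegCycleFrom r := by
  constructor
  · rintro ⟨e, -, he⟩
    by_contra hneg
    have hs : d (G.src e) ≠ ⊤ := by
      intro hs
      simp [hs] at he
    obtain ⟨a, ha'⟩ := WithTop.ne_top_iff_exists.1 hs
    obtain ⟨es, hes, hw⟩ := ha _ _ ha'.symm
    -- The path attaining the value at the source, prolonged by `e`, is lighter than the value at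
    -- the target.
    have := hb.le_of_not_hasNegCycle hk hneg (isPath_concat hes)
    rw [pathWeight_append, hw] at this
    refine absurd this (not_le.2 ?_)
    rw [← ha'] at he
    simpa [pathWeight] using he
  · rintro ⟨v, es, hv, hc, hw⟩
    by_contra! hred
    have hfin := fun v (hv : G.Reachable r v) => hb.ne_top hk hv
    -- Going once around the cycle compares `d v` with itself and shows that the weight is
    -- non-negative.
    have := le_add_pathWeight hfin hred hv hc.2.1
    obtain ⟨a, ha'⟩ := WithTop.ne_top_iff_exists.1 (hfin v hv)
    rw [← ha'] at this
    have : a ≤ a + G.pathWeight es := by exact_mod_cast this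
    omega

theorem exists_isDist {k : ℕ} (ha : Attained r d) (hb : BoundedBy r k d)
    (hk : Nat.card G.V ≤ k + 1) (hneg : ¬ G.HasNegCycleFrom r) {v : G.V} (hv : G.Reachable r v) :
    ∃ a : ℤ, d v = a ∧ G.IsDist r v a := by
  obtain ⟨a, ha'⟩ := WithTop.ne_top_iff_exists.1 (hb.ne_top hk hv)
  refine ⟨a, ha'.symm, ha v a ha'.symm, ?_⟩
  rintro _ ⟨es, hes, rfl⟩
  have := hb.le_of_not_hasNegCycle hk hneg hes
  rw [← ha'] at this
  exact_mod_cast this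

theorem Attained.eq_top (ha : Attained r d) {v : G.V} (hv : ¬ G.Reachable r v) : d v = ⊤ := by
  by_contra h
  obtain ⟨a, ha'⟩ := WithTop.ne_top_iff_exists.1 h
  obtain ⟨es, hes, -⟩ := ha v a ha'.symm
  exact hv ⟨es, hes⟩

/-! ### Mark patterns of a sweep, and the count behind the loop variants -/

theorem ncard_update {A : Type*} [Finite A] {f : A → Mark} {v : A} {m m' : Mark} (hv : f v = m)
    (hm : m' ≠ m) : {a | Function.update f v m' a = m}.ncard + 1 = {a | f a = m}.ncard := by
  have : {a | Function.update f v m' a = m} = {a | f a = m} \ {v} := by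
    ext a
    by_cases ha : a = v
    · subst ha; simp [hm]
    · simp [ha]
  rw [this]
  exact Set.ncard_sdiff_singleton_add_one hv (Set.toFinite _)

/-- Isolated nodes other than the source. -/
def Isolated (r v : G.V) : Prop := v ≠ r ∧ ∀ e, G.src e ≠ v ∧ G.tgt e ≠ v

/-- The node marks that occur in the main part of the program. -/
def Marked (r : G.V) (nm : G.V → Mark) : Prop :=
  ∀ v, nm v = .blue ∨ nm v = .grey ∨ nm v = .unmarked ∧ Isolated r v

theorem Marked.ne_green {nm : G.V → Mark} (h : Marked r nm) (v : G.V) : nm v ≠ .green := by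
  rcases h v with h | h | ⟨h, -⟩ <;> simp [h]

theorem Marked.tgt_ne {nm : G.V → Mark} (h : Marked r nm) (e : G.E) :
    nm (G.tgt e) ≠ .unmarked := by
  rcases h (G.tgt e) with h | h | ⟨h, hi⟩
  · simp [h]
  · simp [h]
  · exact ((hi.2 e).2 rfl).elim

theorem Marked.src {nm : G.V → Mark} (h : Marked r nm) (e : G.E) :
    nm (G.src e) = .blue ∨ nm (G.src e) = .grey := by
  rcases h (G.src e) with h | h | ⟨h, hi⟩
  · exact .inl h
  · exact .inr h
  · exact ((hi.2 e).1 rfl).elim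

theorem Marked.update {nm : G.V → Mark} (h : Marked r nm) {v : G.V} {m : Mark}
    (hm : m = .blue ∨ m = .grey ∨ m = .unmarked ∧ Isolated r v) :
    Marked r (Function.update nm v m) := by
  intro u
  by_cases hu : u = v
  · subst hu; rw [Function.update_self]; exact hm
  · rw [Function.update_of_ne hu]; exact h u

/-- The outgoing edges of blue nodes are unmarked, and those of grey nodes are blue. -/
structure Swept (r : G.V) (s : St G) : Prop where
  marked : Marked r s.nm
  rt : s.rt = none
  em_blue : ∀ e, s.nm (G.src e) = .blue → s.em e = .unmarked
  em_grey : ∀ e, s.nm (G.src e) = .grey → s.em e = .blue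

/-- As `Swept`, while the node `v` is being processed. -/
structure Active (r : G.V) (s : St G) (v : G.V) : Prop where
  marked : Marked r s.nm
  rt : s.rt = some v
  blue : s.nm v = .blue
  em_blue : ∀ e, G.src e ≠ v → s.nm (G.src e) = .blue → s.em e = .unmarked
  em_grey : ∀ e, s.nm (G.src e) = .grey → s.em e = .blue
  em_self : ∀ e, G.src e = v → s.em e = .unmarked ∨ s.em e = .blue

theorem Active.em_cases {s : St G} {v : G.V} (h : Active r s v) (e : G.E) :
    s.em e = .unmarked ∨ s.em e = .blue := by
  by_cases hv : G.src e = v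
  · exact h.em_self e hv
  · rcases h.marked.src e with hb | hg
    · exact .inl (h.em_blue e hv hb)
    · exact .inr (h.em_grey e hg)

theorem Active.update_em {s : St G} {v : G.V} (h : Active r s v) {e : G.E} (he : G.src e = v)
    {m : Mark} (hm : m = .unmarked ∨ m = .blue) (d : G.V → WithTop ℤ) (c : ℤ) :
    Active r { s with em := Function.update s.em e m, d := d, c := c } v := by
  have hne : ∀ f, G.src f ≠ v → Function.update s.em e m f = s.em f := fun f hf =>
    Function.update_of_ne (fun hfe => hf (by rw [hfe, he])) _ _
  refine ⟨h.marked, h.rt, h.blue, fun f hf hb => ?_, fun f hg => ?_, fun f hf => ?_⟩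
  · exact (hne f hf).trans (h.em_blue f hf hb)
  · refine (hne f fun hf => ?_).trans (h.em_grey f hg)
    have hg : s.nm (G.src f) = .grey := hg
    rw [hf, h.blue] at hg
    cases hg
  · by_cases hfe : f = e
    · subst hfe; simpa using hm
    · simpa [hfe] using h.em_self f hf

theorem Swept.root1 {s : St G} (h : Swept r s) {v : G.V} (hv : s.nm v = .blue) :
    Active r { s with nm := Function.update s.nm v .blue, rt := some v } v := by
  have hnm : Function.update s.nm v .blue = s.nm := Function.update_eq_self_iff.2 hv.symm
  rw [hnm]
  exact ⟨h.marked, rfl, hv, fun e _ => h.em_blue e, h.em_grey,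
    fun e he => .inl (h.em_blue e (he ▸ hv))⟩

/-- The node turns blue while its outgoing edges are still blue; this is why `em_blue` in `Active`
exempts `v` and `em_self` admits both marks. -/
theorem Swept.root2 {s : St G} (h : Swept r s) {v : G.V} (hv : s.nm v = .grey) :
    Active r { s with nm := Function.update s.nm v .blue, rt := some v } v := by
  refine ⟨h.marked.update (.inl rfl), rfl, by simp, fun e he hb => ?_,
    fun e hg => ?_, fun e he => .inr (h.em_grey e (he ▸ hv))⟩
  · simp only [Function.update_of_ne he] at hb
    exact h.em_blue e hb
  · by_cases he : G.src e = v
    · exact h.em_grey e (he ▸ hv)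
    · simp only [Function.update_of_ne he] at hg
      exact h.em_grey e hg

theorem Active.unroot1 {s : St G} {v : G.V} (h : Active r s v)
    (hv : ∀ e, G.src e = v → s.em e = .blue) :
    Swept r { s with nm := Function.update s.nm v .grey, rt := none } := by
  refine ⟨h.marked.update (.inr (.inl rfl)), rfl, fun e hb => ?_, fun e hg => ?_⟩
  · by_cases he : G.src e = v
    · simp [he] at hb
    · simp only [Function.update_of_ne he] at hb
      exact h.em_blue e he hb
  · by_cases he : G.src e = v
    · exact hv e he
    · simp only [Function.update_of_ne he] at hg
      exact h.em_grey e hg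

theorem Active.unroot2 {s : St G} {v : G.V} (h : Active r s v)
    (hv : ∀ e, G.src e = v → s.em e = .unmarked) :
    Swept r { s with nm := Function.update s.nm v .blue, rt := none } := by
  have hnm : Function.update s.nm v .blue = s.nm := Function.update_eq_self_iff.2 h.blue.symm
  rw [hnm]
  refine ⟨h.marked, rfl, fun e hb => ?_, h.em_grey⟩
  by_cases he : G.src e = v
  · exact hv e he
  · exact h.em_blue e he hb

/-- No edge touches `v`, so the conditions on edges are unaffected and no endpoint of an edge
becomes unmarked. -/
theorem Active.no_deg {s : St G} {v : G.V} (h : Active r s v) (hv : Isolated r v) :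
    Swept r { s with nm := Function.update s.nm v .unmarked, rt := none } := by
  have hne : ∀ e, Function.update s.nm v .unmarked (G.src e) = s.nm (G.src e) := fun e =>
    Function.update_of_ne (hv.2 e).1 _ _
  refine ⟨h.marked.update (.inr (.inr ⟨rfl, hv⟩)), rfl, fun e hb => ?_, fun e hg => ?_⟩
  · exact h.em_blue e (hv.2 e).1 ((hne e).symm.trans hb)
  · exact h.em_grey e ((hne e).symm.trans hg)

/-! ### Loops over the nodes and over their outgoing edges -/

section sweep

/-- The command `op`, executed when `e` is the only red edge, changes only the tentative distances
and the counter, and it maintains the property `J` of the set of processed edges, the tentative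
distances and the counter. -/
def Processes (r : G.V) (op : Cmd) (J : Set G.E → (G.V → WithTop ℤ) → ℤ → Prop) : Prop :=
  ∀ (s : St G) (e : G.E) (P : Set G.E) (H : HostGraph) (Q : HostGraph → Prop) (F : Prop),
    Enc r s H → Marked r s.nm → RedEdge s e → J P s.d s.c →
    (∀ d' c' H', Enc r { s with d := d', c := c' } H' → J (insert e P) d' c' → Q H') →
    Good Q F (.run op H)

variable {op : Cmd} {J : Set G.E → (G.V → WithTop ℤ) → ℤ → Prop} {s : St G} {H : HostGraph}
  {Q : HostGraph → Prop} {F : Prop}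

/-- The set of edges that have been processed. -/
def St.done (s : St G) : Set G.E := {e | s.em e = .blue}

/-- The set of processed edges is read off from the blue marks, so `J` needs no additional
bookkeeping. Each iteration consumes one unmarked edge. -/
theorem good_process_edges (hG : IsInput G) (hop : Processes r op J) {v : G.V} (hE : Enc r s H)
    (hA : Active r s v) (hJ : J s.done s.d s.c)
    (happ : ∀ s' H', Enc r s' H' → Active r s' v → s'.nm = s.nm →
      (∀ e, G.src e = v → s'.em e = .blue) → J s'.done s'.d s'.c → Q H') :
    Good Q F (.run (.loop (.seq (rule unmarked_edge) (.seq op (rule finish)))) H) := by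
  have := G.finE
  refine Good.loop (A := St G) (a := s) (fun s' H' => Enc r s' H' ∧ Active r s' v ∧ s'.nm = s.nm ∧
    J s'.done s'.d s'.c) (fun s' => {e | s'.em e = .unmarked}.ncard) ?_ ⟨hE, hA, rfl, hJ⟩
  rintro s₁ H₁ ⟨hE, hA, hnm, hJ⟩
  refine Good.seq (good_edge (Q := fun H' => ∃ e, G.src e = v ∧ s₁.em e = .unmarked ∧
    Enc r { s₁ with em := Function.update s₁.em e .red } H') hG hE hA.blue hA.rt nofun
    hA.marked.tgt_ne ?_ ?_) ?_
  · exact fun e he hem H' hE' => ⟨e, he, hem, hE'⟩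
  · intro h
    exact happ s₁ H₁ hE hA hnm (fun e he => (hA.em_self e he).resolve_left (h e he)) hJ
  rintro H₂ ⟨e, rfl, hem, hE₂⟩
  have hred : RedEdge { s₁ with em := Function.update s₁.em e .red } e := by
    refine ⟨hA.rt, hA.blue, hA.marked.tgt_ne e, by simp, fun f hf => ?_⟩
    by_contra hfe
    simp only [Function.update_of_ne hfe] at hf
    rcases hA.em_cases f with h | h <;> simp [h] at hf
  refine Good.seq (hop _ e s₁.done H₂ (fun H' => ∃ d' c', J (insert e s₁.done) d' c' ∧
    Enc r { s₁ with em := Function.update s₁.em e .red, d := d', c := c' } H') _ hE₂ hA.marked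
    hred hJ fun d' c' H' hE' hJ' => ⟨d', c', hJ', hE'⟩) ?_
  rintro H₃ ⟨d', c', hJ₃, hE₃⟩
  refine good_edge hG hE₃ hA.blue hA.rt nofun hA.marked.tgt_ne ?_ ?_
  · intro f _ hf H₄ hE₄
    obtain rfl : f = e := hred.unique f hf
    simp only [Function.update_idem] at hE₄
    refine ⟨_, ?_, hE₄, hA.update_em rfl (.inr rfl) d' c', hnm, ?_⟩
    · have := ncard_update (m' := .blue) hem nofun
      dsimp only
      omega
    · have : St.done { s₁ with em := Function.update s₁.em f .blue, d := d', c := c' } =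
          insert f s₁.done := by
        ext f'
        by_cases hff : f' = f
        · subst hff; simp [St.done]
        · simp [St.done, hff]
      rw [this]
      exact hJ₃
  · intro h
    exact (h e rfl hred.red).elim

theorem good_clean_edges (hG : IsInput G) {v : G.V} (hE : Enc r s H) (hA : Active r s v)
    (happ : ∀ em H', Enc r { s with em := em } H' → Active r { s with em := em } v →
      (∀ e, G.src e = v → em e = .unmarked) → Q H') :
    Good Q F (.run (.loop (rule unmark_edge)) H) := by
  have := G.finE
  refine Good.loop (A := G.E → Mark) (a := s.em) (fun em H' => Enc r { s with em := em } H' ∧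
    Active r { s with em := em } v) (fun em => {e | em e = .blue}.ncard) ?_ ⟨hE, hA⟩
  rintro em H₁ ⟨hE, hA⟩
  refine good_edge hG hE hA.blue hA.rt nofun hA.marked.tgt_ne ?_ ?_
  · intro e he hem H' hE'
    refine ⟨Function.update em e .unmarked, ?_, hE', hA.update_em he (.inl rfl) s.d s.c⟩
    have hem : em e = .blue := hem
    have := ncard_update (m' := .unmarked) hem nofun
    omega
  · intro h
    exact happ em H₁ hE hA fun e he => (hA.em_self e he).resolve_right (h e he)

theorem good_unroot1 (hG : IsInput G) {v : G.V} (hop : Processes r op J) (hE : Enc r s H)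
    (hA : Active r s v) (hJ : J s.done s.d s.c)
    (happ : ∀ s' H', Enc r s' H' → Swept r s' → s'.nm = Function.update s.nm v .grey →
      J s'.done s'.d s'.c → Q H') :
    Good Q F (.run (.seq (.loop (.seq (rule unmarked_edge) (.seq op (rule finish))))
      (rule unroot1)) H) := by
  refine Good.seq (good_process_edges (Q := fun H' => ∃ s', Enc r s' H' ∧ Active r s' v ∧
    s'.nm = s.nm ∧ (∀ e, G.src e = v → s'.em e = .blue) ∧ J s'.done s'.d s'.c) hG hop hE hA hJ
    fun s' H' h1 h2 h3 h4 h5 => ⟨s', h1, h2, h3, h4, h5⟩) ?_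
  rintro H' ⟨s', h1, h2, h3, h4, h5⟩
  refine good_leave h1 h2.blue h2.rt fun H'' hE'' => ?_
  exact happ _ _ hE'' (h2.unroot1 h4) (by rw [← h3]) h5

/-- Each iteration takes one node out of the blue ones: an isolated node becomes unmarked, any other
grey. An isolated node has no edges to process, so skipping it preserves `J`. -/
theorem good_relax_loop (hG : IsInput G)
    (hop : Processes r (.tryte (.call [unvisited, reduce]) .skip .skip) J) (hE : Enc r s H)
    (hS : Swept r s) (hJ : J s.done s.d s.c)
    (happ : ∀ s' H', Enc r s' H' → Swept r s' → (∀ v, s'.nm v ≠ .blue) →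
      J s'.done s'.d s'.c → Q H') :
    Good Q F (.run (.loop Relax) H) := by
  have := G.finV
  refine Good.loop (A := St G) (a := s) (fun s' H' => Enc r s' H' ∧ Swept r s' ∧
    J s'.done s'.d s'.c) (fun s' => {v | s'.nm v = .blue}.ncard) ?_ ⟨hE, hS, hJ⟩
  rintro s₁ H₁ ⟨hE, hS, hJ⟩
  refine Good.seq (good_enter (Q := fun H' => ∃ v, s₁.nm v = .blue ∧
    Enc r { s₁ with nm := Function.update s₁.nm v .blue, rt := some v } H') hE nofun hS.rt
    (fun v hv H' hE' => ⟨v, hv, hE'⟩) fun h => happ s₁ H₁ hE hS h hJ) ?_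
  rintro H₂ ⟨v, hv, hE₂⟩
  have hA := hS.root1 hv
  refine Good.tryte (good_no_deg_state hE₂ hA.blue rfl ?_ ?_)
  · intro hiso H₃ hE₃
    refine Good.skip ⟨_, ?_, hE₃, hA.no_deg hiso, hJ⟩
    have := ncard_update (m' := .unmarked) hv nofun
    simp only [Function.update_idem]
    omega
  · intro _
    refine good_unroot1 hG hop hE₂ hA hJ fun s₃ H₃ hE₃ hS₃ hnm hJ₃ => ⟨s₃, ?_, hE₃, hS₃, hJ₃⟩
    have := ncard_update (m' := .grey) hv nofun
    simp only [hnm, Function.update_idem]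
    omega

theorem good_check_loop (hG : IsInput G) (hop : Processes r op J) (hE : Enc r s H)
    (hS : Swept r s) (hJ : J s.done s.d s.c)
    (happ : ∀ s' H', Enc r s' H' → Swept r s' → (∀ v, s'.nm v ≠ .blue) →
      J s'.done s'.d s'.c → Q H') :
    Good Q F (.run (.loop (.seq (rule root1) (.seq (.loop (.seq (rule unmarked_edge)
      (.seq op (rule finish)))) (rule unroot1)))) H) := by
  have := G.finV
  refine Good.loop (A := St G) (a := s) (fun s' H' => Enc r s' H' ∧ Swept r s' ∧
    J s'.done s'.d s'.c) (fun s' => {v | s'.nm v = .blue}.ncard) ?_ ⟨hE, hS, hJ⟩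
  rintro s₁ H₁ ⟨hE, hS, hJ⟩
  refine Good.seq (good_enter (Q := fun H' => ∃ v, s₁.nm v = .blue ∧
    Enc r { s₁ with nm := Function.update s₁.nm v .blue, rt := some v } H') hE nofun hS.rt
    (fun v hv H' hE' => ⟨v, hv, hE'⟩) fun h => happ s₁ H₁ hE hS h hJ) ?_
  rintro H₂ ⟨v, hv, hE₂⟩
  have hA := hS.root1 hv
  refine good_unroot1 hG hop hE₂ hA hJ fun s₃ H₃ hE₃ hS₃ hnm hJ₃ => ⟨s₃, ?_, hE₃, hS₃, hJ₃⟩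
  have := ncard_update (m' := .grey) hv nofun
  simp only [hnm, Function.update_idem]
  omega

theorem good_clean_loop (hG : IsInput G) (hE : Enc r s H) (hS : Swept r s)
    (happ : ∀ s' H', Enc r s' H' → Swept r s' → (∀ v, s'.nm v ≠ .grey) → s'.d = s.d →
      s'.c = s.c → Q H') :
    Good Q F (.run (.loop Clean) H) := by
  have := G.finV
  refine Good.loop (A := St G) (a := s) (fun s' H' => Enc r s' H' ∧ Swept r s' ∧
    s'.d = s.d ∧ s'.c = s.c) (fun s' => {v | s'.nm v = .grey}.ncard) ?_ ⟨hE, hS, rfl, rfl⟩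
  rintro s₁ H₁ ⟨hE, hS, hd, hc⟩
  refine Good.seq (good_enter (Q := fun H' => ∃ v, s₁.nm v = .grey ∧
    Enc r { s₁ with nm := Function.update s₁.nm v .blue, rt := some v } H') hE nofun hS.rt
    (fun v hv H' hE' => ⟨v, hv, hE'⟩) fun h => happ s₁ H₁ hE hS h hd hc) ?_
  rintro H₂ ⟨v, hv, hE₂⟩
  have hA := hS.root2 hv
  refine Good.seq (good_clean_edges (Q := fun H' => ∃ em, Enc r { s₁ with
    nm := Function.update s₁.nm v .blue, rt := some v, em := em } H' ∧ Active r { s₁ with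
    nm := Function.update s₁.nm v .blue, rt := some v, em := em } v ∧
    ∀ e, G.src e = v → em e = .unmarked) hG hE₂ hA fun em H' h1 h2 h3 => ⟨em, h1, h2, h3⟩) ?_
  rintro H₃ ⟨em, hE₃, hA₃, hem⟩
  refine good_leave hE₃ hA₃.blue hA₃.rt fun H₄ hE₄ => ⟨_, ?_, hE₄, hA₃.unroot2 hem, hd, hc⟩
  have := ncard_update (m' := .blue) hv nofun
  simp only [Function.update_idem]
  omega

end sweep

/-! ## The phases of the program -/

/-- Here `d₀` holds the distances at the start of the round. Values only decrease, so relaxing with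
the current source value is at least as good as with `d₀`, and later relaxations preserve the bound.
-/
theorem processes_relax (hG : IsInput G) (d₀ : G.V → WithTop ℤ) (c₀ : ℤ) :
    Processes r (.tryte (.call [unvisited, reduce]) .skip .skip) fun P d c =>
      c = c₀ ∧ Attained r d ∧ d ≤ d₀ ∧
        ∀ e ∈ P, d (G.tgt e) ≤ d₀ (G.src e) + (G.weight e : WithTop ℤ) := by
  rintro s e P H Q F hE - he ⟨hc, ha, hle, hP⟩ happ
  refine good_relax hG hE he fun H' hE' => happ _ _ _ hE' ⟨hc, ha.relax e,
    (relax_le _ _).trans hle, ?_⟩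
  rintro f (rfl | hf)
  · refine (relax_tgt_le _ _).trans ?_
    gcongr
    exact hle _
  · exact (relax_le _ _ _).trans (hP f hf)

/-- The check leaves the distances alone, so reducibility is always tested against `d₀`. The counter
is 0 before the check, hence -1 can serve as the flag. -/
theorem processes_check (hG : IsInput G) (d₀ : G.V → WithTop ℤ) :
    Processes r (.ite (rule reduce) (rule set_flag) .skip) fun P d c =>
      d = d₀ ∧ c = if ∃ e ∈ P, Reducible d₀ e then -1 else 0 := by
  rintro s e P H Q F hE hm he ⟨hd, hc⟩ happ
  refine good_if_reduce hG hE hm.ne_green he fun H' hE' => happ _ _ _ hE' ⟨hd, ?_⟩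
  rw [hd, hc]
  by_cases h1 : Reducible d₀ e
  · simp [h1]
  · simp [h1]

/-- The invariant of the main loop: after `k` rounds, the tentative distances are at most the
weights of the paths with at most `k` edges. -/
structure Round (r : G.V) (s : St G) (k : ℕ) : Prop where
  swept : Swept r s
  ne_grey : ∀ v, s.nm v ≠ .grey
  attained : Attained r s.d
  bounded : BoundedBy r k s.d
  counter : k + s.c + 1 = Nat.card G.V
  nonneg : 0 ≤ s.c

theorem Round.done_eq {s : St G} {k : ℕ} (h : Round r s k) : s.done = ∅ := by
  ext e
  simp only [St.done, Set.mem_ofPred_eq, Set.mem_empty_iff_false, iff_false]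
  rw [h.swept.em_blue e ((h.swept.marked.src e).resolve_right (h.ne_grey _))]
  nofun

theorem Swept.em_eq_blue {s : St G} (h : Swept r s) (hb : ∀ v, s.nm v ≠ .blue) (e : G.E) :
    s.em e = .blue :=
  h.em_grey e ((h.marked.src e).resolve_left (hb _))

theorem good_main_loop (hG : IsInput G) {s : St G} {H : HostGraph} {Q : HostGraph → Prop}
    {F : Prop} {k : ℕ} (hE : Enc r s H) (hR : Round r s k)
    (happ : ∀ s' k' H', Enc r s' H' → Round r s' k' → s'.c = 0 → Q H') :
    Good Q F (.run (.loop (.seq (rule decrement) (.seq (.loop Relax) (.loop Clean)))) H) := by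
  refine Good.loop (A := St G) (a := s) (fun s' H' => Enc r s' H' ∧ ∃ k', Round r s' k')
    (fun s' => s'.c.toNat) ?_ ⟨hE, k, hR⟩
  rintro s₁ H₁ ⟨hE, k₁, hR⟩
  refine Good.seq (good_decrement (Q := fun H' => 0 < s₁.c ∧ Enc r { s₁ with c := s₁.c - 1 } H')
    hE hR.swept.marked.ne_green (fun h H' hE' => ⟨h, hE'⟩)
    fun h => happ s₁ k₁ H₁ hE hR (le_antisymm h hR.nonneg)) ?_
  rintro H₂ ⟨hpos, hE₂⟩
  refine Good.seq (good_relax_loop (Q := fun H' => ∃ s', Enc r s' H' ∧ Swept r s' ∧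
    (∀ v, s'.nm v ≠ .blue) ∧ s'.c = s₁.c - 1 ∧ Attained r s'.d ∧ s'.d ≤ s₁.d ∧
      ∀ e ∈ s'.done, s'.d (G.tgt e) ≤ s₁.d (G.src e) + (G.weight e : WithTop ℤ)) hG
    (processes_relax hG s₁.d (s₁.c - 1)) hE₂
    ⟨hR.swept.marked, hR.swept.rt, hR.swept.em_blue, hR.swept.em_grey⟩ ?_ ?_) ?_
  · refine ⟨rfl, hR.attained, le_rfl, fun e he => ?_⟩
    have he : e ∈ s₁.done := he
    rw [hR.done_eq] at he
    exact he.elim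
  · exact fun s' H' h1 h2 h3 h4 => ⟨s', h1, h2, h3, h4⟩
  rintro H₃ ⟨s₃, hE₃, hS₃, hb, hc, ha, hle, hdone⟩
  refine good_clean_loop hG hE₃ hS₃ fun s₄ H₄ hE₄ hS₄ hg hd₄ hc₄ => ⟨s₄, ?_, hE₄, k₁ + 1, ?_⟩
  · omega
  · refine ⟨hS₄, hg, hd₄ ▸ ha, ?_, ?_, by omega⟩
    · rw [hd₄]
      -- When no blue node remains, every edge is blue, so all edges were relaxed in this round.
      exact hR.bounded.succ hle fun e => hdone e (hS₃.em_eq_blue hb e)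
    · have := hR.counter
      push_cast
      omega

/-- The counter plus the number of grey nodes stays |V| - 1, because the source is never counted.
Each node is either still grey with nothing appended, or blue with its atom from `d₀`. -/
theorem good_count_loop {Q : HostGraph → Prop} {F : Prop} {H : HostGraph}
    (hR : Rep _ (counterLab r (Function.update (fun _ => []) r [.int 0])
      (Function.update (fun _ => .grey) r .blue) none (fun _ => .unmarked) 0) H)
    (happ : ∀ s H', Enc r s H' → Round r s 0 → Q H') :
    Good Q F (.run (.loop (rule count)) H) := by
  have := G.finV
  let d₀ : G.V → WithTop ℤ := Function.update (fun _ => ⊤) r 0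
  have hd₀ : ∀ v, v ≠ r → distAtom (d₀ v) = .str strF := fun v hv =>
    distAtom_eq_str.2 (Function.update_of_ne hv _ _)
  refine Good.loop (A := (G.V → List Atom) × (G.V → Mark) × ℤ)
    (fun a H' => Rep _ (counterLab r a.1 a.2.1 none (fun _ => .unmarked) a.2.2) H' ∧
      (∀ v, a.2.1 v = .grey ∧ a.1 v = [] ∧ v ≠ r ∨
        a.2.1 v = .blue ∧ a.1 v = [distAtom (d₀ v)]) ∧
      a.2.2 + {v | a.2.1 v = .grey}.ncard + 1 = Nat.card G.V ∧ 0 ≤ a.2.2)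
    (fun a => {v | a.2.1 v = .grey}.ncard) 
    (a := ⟨Function.update (fun _ => []) r [.int 0], Function.update (fun _ => .grey) r .blue, 0⟩)
    ?_
    ⟨hR, fun v => ?_, ?_, le_rfl⟩
  · rintro ⟨t, nm, c⟩ H₁ ⟨hR, hv, hcard, hc⟩
    dsimp only at hR hv hcard hc
    refine good_count_step hR (fun v => ?_) ?_ ?_
    · rcases hv v with ⟨h, -⟩ | ⟨h, -⟩ <;> simp [h]
    · intro v hgrey H' hR'
      have hn := ncard_update (m' := .blue) hgrey nofun
      refine ⟨⟨Function.update t v (t v ++ [.str strF]), Function.update nm v .blue, c + 1⟩, ?_,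
        hR', fun u => ?_, ?_, ?_⟩
      · dsimp only; omega
      · dsimp only
        by_cases hu : u = v
        · subst hu
          rcases hv u with ⟨-, h2, h3⟩ | ⟨h1, -⟩
          · simp [h2, hd₀ u h3]
          · rw [hgrey] at h1; cases h1
        · simpa only [Function.update_of_ne hu] using hv u
      · dsimp only; omega
      · dsimp only; omega
    · intro h
      have hv : ∀ v, nm v = .blue ∧ t v = [distAtom (d₀ v)] := fun v =>
        (hv v).resolve_left fun hg => h v hg.1
      have ht : t = fun v => [distAtom (d₀ v)] := funext fun v => (hv v).2
      have h0 : {v | nm v = .grey} = ∅ := Set.eq_empty_of_forall_notMem h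
      rw [h0, Set.ncard_empty] at hcard
      subst ht
      refine happ ⟨d₀, nm, none, fun _ => .unmarked, c⟩ H₁ hR
        ⟨⟨fun v => .inl (hv v).1, rfl, fun _ _ => rfl, fun e he => absurd he (h _)⟩, h,
          attained_init, boundedBy_init, ?_, hc⟩
      dsimp only
      omega
  · by_cases h : v = r
    · subst h
      simp [d₀, distAtom_eq_int.2]
    · simp [h]
  · have : {v | Function.update (fun _ : G.V => Mark.grey) r .blue v = .grey} =
        Set.univ \ {r} := by
      ext v
      by_cases h : v = r
      · subst h; simp
      · simp [h]
    have h1 := Set.ncard_sdiff_singleton_add_one (Set.mem_univ r) (Set.toFinite _)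
    rw [← this, Set.ncard_univ] at h1
    dsimp only
    omega

theorem good_no_deg_inv_loop {H : HostGraph} {Q : HostGraph → Prop} {F : Prop}
    {t : G.V → List Atom} {nm : G.V → Mark} {em : G.E → Mark} (hR : Rep _ (outputLab t nm em) H)
    (hnm : ∀ v, nm v = .grey ∨ nm v = .unmarked)
    (happ : ∀ H', Rep _ (outputLab t (fun _ => .grey) em) H' → Q H') :
    Good Q F (.run (.loop (rule no_deg_inv)) H) := by
  have := G.finV
  refine Good.loop (A := G.V → Mark) (a := nm) (fun nm H' => Rep _ (outputLab t nm em) H' ∧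
    ∀ v, nm v = .grey ∨ nm v = .unmarked) (fun nm => {v | nm v = .unmarked}.ncard) ?_ ⟨hR, hnm⟩
  rintro nm H₁ ⟨hR, hnm⟩
  refine good_no_deg_inv hR (fun v hv H' hR' => ⟨_, ?_, hR', fun u => ?_⟩) fun h => happ H₁ ?_
  · have := ncard_update (m' := .grey) hv nofun
    omega
  · by_cases hu : u = v
    · subst hu; simp
    · simpa [hu] using hnm u
  · have : nm = fun _ => .grey := funext fun v => (hnm v).resolve_right (h v)
    exact this ▸ hR

theorem good_final (hG : IsInput G) (hr : G.root r) {s : St G} {H : HostGraph} {k : ℕ}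
    (hE : Enc r s H) (hR : Round r s k) (hc : s.c = 0) :
    Good (fun H => ¬ G.HasNegCycleFrom r ∧ IsOutput G r H) (G.HasNegCycleFrom r)
      (.run Final H) := by
  have hk : Nat.card G.V ≤ k + 1 := by
    have := hR.counter
    omega
  have hred := exists_reducible_iff hR.attained hR.bounded hk
  refine Good.seq (good_check_loop (Q := fun H' => ∃ s', Enc r s' H' ∧ Swept r s' ∧
    (∀ v, s'.nm v ≠ .blue) ∧ s'.d = s.d ∧
      s'.c = if ∃ e ∈ s'.done, Reducible s.d e then -1 else 0) hG
    (processes_check hG s.d) hE hR.swept ⟨rfl, ?_⟩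
    fun s' H' h1 h2 h3 h4 => ⟨s', h1, h2, h3, h4⟩) ?_
  · rw [hc, hR.done_eq]; simp
  rintro H₁ ⟨s₁, hE₁, hS₁, hb, hd, hc₁⟩
  have hem := hS₁.em_eq_blue hb
  -- All edges are blue by now, so the check has covered every edge of the graph.
  have hc₁ : s₁.c = if G.HasNegCycleFrom r then -1 else 0 := by
    rw [hc₁]
    congr 1
    rw [← hred]
    simp [St.done, hem]
  have hgu : ∀ v, s₁.nm v = .grey ∨ s₁.nm v = .unmarked := fun v =>
    ((hS₁.marked v).resolve_left (hb v)).imp_right And.left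
  -- The source is never unmarked, since `Isolated` excludes it; `delete_counter` needs it grey.
  have hrg : s₁.nm r = .grey :=
    ((hS₁.marked r).resolve_left (hb r)).resolve_right fun h => h.2.1 rfl
  refine Good.seq (Q' := fun H' => ¬ G.HasNegCycleFrom r ∧ H' = H₁)
    (Good.ite (good_flag hE₁ hS₁.marked.ne_green ?_ ?_)) ?_
  · intro h _
    refine Good.fail ?_
    by_contra hneg
    simp [hc₁, hneg] at h
  · intro h
    refine Good.skip ⟨fun hneg => h ?_, rfl⟩
    simp [hc₁, hneg]
  rintro H₁ ⟨hneg, rfl⟩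
  have hE₁ : Rep _ (s₁.lab r) H₁ := hE₁
  rw [St.lab, hS₁.rt] at hE₁
  refine Good.seq (good_delete_counter (Q := fun H' =>
    Rep _ (outputLab (fun v => [distAtom (s₁.d v)]) s₁.nm s₁.em) H') hG hr hE₁ hrg
    hS₁.marked.ne_green (fun e => by simp [hem e]) fun _ h => h) fun H₂ hR₂ => ?_
  refine good_no_deg_inv_loop hR₂ hgu fun H₃ ⟨φ, ψ, h⟩ => ⟨hneg, φ, ψ, h.src, h.tgt, h.elist,
    fun e => (h.emark e).trans (hem e), fun v => (h.mark v).trans (hG.grey v).symm, h.root,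
    fun v hv => ?_, fun v hv => ?_⟩
  · obtain ⟨a, ha, hdist⟩ := exists_isDist hR.attained hR.bounded hk hneg hv
    refine ⟨a, hdist, (h.list v).trans ?_⟩
    simp [outputLab, hd, ha, distAtom_coe]
  · refine (h.list v).trans ?_
    simp [outputLab, hd, hR.attained.eq_top hv, distAtom_top]

theorem good_program (hG : IsInput G) (hr : G.root r) :
    Good (fun H => ¬ G.HasNegCycleFrom r ∧ IsOutput G r H) (G.HasNegCycleFrom r)
      (.run program G) := by
  refine Good.seq (good_set_counter hG hr fun H' h => h) fun H₁ hR₁ => ?_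
  refine Good.seq (good_count_loop (Q := fun H' => ∃ s, Enc r s H' ∧ Round r s 0) hR₁
    fun s H' h1 h2 => ⟨s, h1, h2⟩) ?_
  rintro H₂ ⟨s₂, hE₂, hR₂⟩
  refine Good.seq (good_main_loop (Q := fun H' => ∃ s k, Enc r s H' ∧ Round r s k ∧ s.c = 0) hG
    hE₂ hR₂ fun s k H' h1 h2 h3 => ⟨s, k, h1, h2, h3⟩) ?_
  rintro H₃ ⟨s₃, k, hE₃, hR₃, hc₃⟩
  exact good_final hG hr hE₃ hR₃ hc₃

end BellmanFord

end GP2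

/-- In `good_program` the postcondition includes the negation of the failure condition, so a single
judgement settles both cases. -/
theorem mainTheorem1 (G : GP2.HostGraph) (hG : GP2.BellmanFord.IsInput G)
    (r : G.V) (hr : G.root r) :
    GP2.Outcome.bottom ∉ GP2.sem GP2.BellmanFord.program G ∧
    (G.HasNegCycleFrom r →
      GP2.sem GP2.BellmanFord.program G = {GP2.Outcome.fail}) ∧
    (¬ G.HasNegCycleFrom r →
      (GP2.sem GP2.BellmanFord.program G).Nonempty ∧
      ∀ X ∈ GP2.sem GP2.BellmanFord.program G,
        ∃ H, X = GP2.Outcome.graph H ∧ GP2.BellmanFord.IsOutput G r H) := by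
  have h := GP2.BellmanFord.good_program hG hr
  refine ⟨h.bottom_notMem_sem, fun hneg => ?_, fun hneg => ⟨h.sem_nonempty, fun X hX => ?_⟩⟩
  · refine h.sem_nonempty.subset_singleton_iff.1 fun X hX => ?_
    rcases h.of_mem_sem hX with ⟨H, -, hH⟩ | ⟨rfl, -⟩
    · exact absurd hneg hH.1
    · rfl
  · rcases h.of_mem_sem hX with ⟨H, rfl, hH⟩ | ⟨-, hF⟩
    · exact ⟨H, rfl, hH.2⟩
    · exact absurd hF hneg
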